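/- For $b>0$ let $H_b$ be the non-negative self-adjoint operator in $L_2(b,b+1)$ associated with the closed quadratic form $$h_b[u]=\int_b^{b+1}\left|\frac{d}{dr}\left(\frac{u(r)}{\sqrt r}\right)\right|^2 r\,dr,\qquad u\in H^1(b,b+1),$$ that is, $-\frac{d^2}{dr^2}-\frac1{4r^2}$ on $(b,b+1)$ with the boundary conditions $u'(b)-\frac{u(b)}{2b}=0=u'(b+1)-\frac{u(b+1)}{2(b+1)}$. For every $b,k>0$ the resolvent $(H_b+k^2)^{-1}$ exists and is an integral operator with a real-valued continuous kernel $G_b(\cdot,\cdot,k)$ on $[b,b+1]\times[b,b+1]$, i.e. $$\left((H_b+k^2)^{-1}u\right)(r)=\int_b^{b+1}G_b(r,s,k)\,u(s)\,ds,\qquad u\in L_2(b,b+1).$$ Let $k>0$ and $0\le\alpha<1$. Then there is a constant $C_\alpha(k)>0$ such that for all $b>0$ and all $b\le r\le b+1$ $$G_b(r,r,k)\le C_\alpha(k)\,r^\alpha .$$ For $\alpha=0$ and $k=3.555$ one may choose $C_0(3.555)=1/3$. -/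

import Mathlib

open MeasureTheory Set
open scoped ContDiff

noncomputable section

namespace RadialNeumann

/-- Lebesgue measure on the interval `(b, b + 1)`. -/
abbrev intervalMeasure (b : ℝ) : Measure ℝ := volume.restrict (Ioo b (b + 1))

/-- The complex Hilbert space `L²(b, b + 1)`. -/
abbrev L2 (b : ℝ) : Type := Lp ℂ 2 (intervalMeasure b)

/-- `w` is a weak derivative of `u` on the open interval `(b, b + 1)`: integration by parts holds
against every smooth function whose support is a compact subset of the open interval. -/
def HasWeakDeriv (b : ℝ) (u w : ℝ → ℂ) : Prop :=
  ∀ φ : ℝ → ℝ, ContDiff ℝ ∞ φ → HasCompactSupport φ → tsupport φ ⊆ Ioo b (b + 1) →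
    ∫ r in Ioo b (b + 1), deriv φ r • u r = -∫ r in Ioo b (b + 1), φ r • w r

/-- The Sobolev space `H¹(b, b + 1)`, as a set of elements of `L²(b, b + 1)`. -/
def MemH1 (b : ℝ) (u : L2 b) : Prop :=
  ∃ w : L2 b, HasWeakDeriv b u w

open Classical in
/-- The square integrable weak derivative of `u` on `(b, b + 1)`, when there is one
(it is then unique up to a null set). -/
def weakDeriv (b : ℝ) (u : ℝ → ℂ) : ℝ → ℂ :=
  if h : ∃ w : ℝ → ℂ, MemLp w 2 (intervalMeasure b) ∧ HasWeakDeriv b u w then h.choose else 0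

/-- The weak derivative `(u / √r)'`; for `b > 0` and `u ∈ H¹(b, b + 1)` it is square integrable. -/
def groundStateDeriv (b : ℝ) (u : L2 b) : ℝ → ℂ :=
  weakDeriv b (fun r => u r / (Real.sqrt r : ℂ))

/-- The sesquilinear form of `h_b[u] = ∫_b^{b+1} |(u / √r)'|² r dr` (conjugate-linear in the
first argument, like Mathlib's inner product), to be used for `u, v ∈ H¹(b, b + 1)`. -/
def form (b : ℝ) (v u : L2 b) : ℂ :=
  ∫ r in Ioo b (b + 1),
    starRingEnd ℂ (groundStateDeriv b v r) * groundStateDeriv b u r * (r : ℂ)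

/-- The graph of the self-adjoint operator `H_b` in `L²(b, b + 1)` that belongs to the closed
form `h_b` with form domain `H¹(b, b + 1)`: `u` lies in the domain of `H_b` and `H_b u = f`. -/
def OperatorGraph (b : ℝ) (u f : L2 b) : Prop :=
  MemH1 b u ∧ ∀ v : L2 b, MemH1 b v → form b v u = inner ℂ v f

/-- The bounded operator `R` is the resolvent `(H_b + k²)⁻¹`: it maps into the domain of `H_b`
and is a two-sided inverse of `H_b + k²`. -/
def IsResolvent (b k : ℝ) (R : L2 b →L[ℂ] L2 b) : Prop :=
  (∀ f : L2 b, OperatorGraph b (R f) (f - ((k ^ 2 : ℝ) : ℂ) • R f)) ∧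
    ∀ u f : L2 b, OperatorGraph b u f → R (f + ((k ^ 2 : ℝ) : ℂ) • u) = u

/-- `G` is the Green's function `G_b(·, ·, k)`: the continuous function on the closed square
`[b, b + 1] × [b, b + 1]` that is the integral kernel of the resolvent `(H_b + k²)⁻¹`.
Continuity determines the values on the diagonal, which is a null set of the square. -/
structure IsGreenFunction (b k : ℝ) (G : ℝ → ℝ → ℝ) : Prop where
  continuousOn : ContinuousOn (fun p : ℝ × ℝ => G p.1 p.2) (Icc b (b + 1) ×ˢ Icc b (b + 1))
  kernel : ∃ R : L2 b →L[ℂ] L2 b, IsResolvent b k R ∧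
    ∀ u : L2 b, R u =ᵐ[intervalMeasure b]
      fun r => ∫ s in Ioo b (b + 1), (G r s : ℂ) * u s

end RadialNeumann

end

/-! Write `u = √r V`. The quadratic form of `H_b + k²` becomes the energy `∫ (|V'|² + k²|V|²) ρ dρ`,
and `G(r,r)` is the squared norm of the evaluation `u ↦ u(r)` in the energy norm. An estimate
`energy ≥ κ |V(r)|²`, valid for all `V`, therefore gives `G(r,r) ≤ r/κ`
(`IsGreenFunction.diagonal_le`).

Such estimates come from Riccati subsolutions: if `q' + q²/ρ ≤ k²ρ`, then completing the square
gives `(q|V|²)' ≤ (|V'|² + k²|V|²) ρ`, and integration bounds the energy by boundary terms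
(`riccati_le`). One weight vanishing at `b` and one vanishing on the right of `r` leave only the
term at `r` (`energy_ge`). Three choices of weights suffice. Linear profiles give a bound
independent of `b`, which settles `r ≥ 1/2`. The weight `c ρ^(1-α) (1-ρ)` gives the factor `r^α` for
`r ≤ 1/2`. For the constant `1/3`, the weights are `ρ` times logarithmic derivatives of polynomials
lying below `I₀(kt)` and `cosh(kt)`.

Existence of `G` is a reproducing kernel argument: `u ↦ (k u, √r (u/√r)')` maps the form domain
isometrically onto a closed subspace of `L² × L²`. Projection onto it yields the resolvent by Riesz
representation, and point evaluation is the pairing with a vector depending continuously on the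
point. -/

noncomputable section

namespace RadialNeumann

/-! ### Test functions and the calculus of weak derivatives -/

/-- Smooth functions whose support is a compact subset of `(b, b + 1)`. -/
structure IsTestFunction (b : ℝ) (φ : ℝ → ℝ) : Prop where
  contDiff : ContDiff ℝ ∞ φ
  hasCompactSupport : HasCompactSupport φ
  tsupport_subset : tsupport φ ⊆ Ioo b (b + 1)

theorem hasWeakDeriv_iff {b : ℝ} {u w : ℝ → ℂ} :
    HasWeakDeriv b u w ↔ ∀ φ, IsTestFunction b φ →
      ∫ r in Ioo b (b + 1), deriv φ r • u r = -∫ r in Ioo b (b + 1), φ r • w r :=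
  ⟨fun h φ hφ => h φ hφ.1 hφ.2 hφ.3, fun h φ h1 h2 h3 => h φ ⟨h1, h2, h3⟩⟩

namespace IsTestFunction

variable {b : ℝ} {φ : ℝ → ℝ}

theorem continuous (h : IsTestFunction b φ) : Continuous φ := h.contDiff.continuous

theorem differentiable (h : IsTestFunction b φ) : Differentiable ℝ φ :=
  h.contDiff.differentiable (by simp)

theorem derivative (h : IsTestFunction b φ) : IsTestFunction b (deriv φ) where
  contDiff := (contDiff_infty_iff_deriv.1 h.contDiff).2
  hasCompactSupport := h.hasCompactSupport.deriv
  tsupport_subset := tsupport_deriv_subset.trans h.tsupport_subset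

theorem apply_eq_zero (h : IsTestFunction b φ) {x : ℝ} (hx : x ∉ Ioo b (b + 1)) : φ x = 0 :=
  image_eq_zero_of_notMem_tsupport fun hx' => hx (h.tsupport_subset hx')

/-- A factor that is smooth on `(0, ∞)` keeps the class of test functions. -/
theorem mul_of_contDiffOn (h : IsTestFunction b φ) (hb : 0 < b) {a : ℝ → ℝ}
    (ha : ContDiffOn ℝ ∞ a (Ioi 0)) : IsTestFunction b (fun r => φ r * a r) where
  contDiff := by
    rw [contDiff_iff_contDiffAt]
    intro x
    by_cases hx : x ∈ tsupport φ
    · exact h.contDiff.contDiffAt.mul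
        (ha.contDiffAt (Ioi_mem_nhds (hb.trans (h.tsupport_subset hx).1)))
    · rw [notMem_tsupport_iff_eventuallyEq] at hx
      refine (contDiffAt_const (c := (0 : ℝ))).congr_of_eventuallyEq ?_
      filter_upwards [hx] with y hy
      simp [hy]
  hasCompactSupport := h.hasCompactSupport.mul_right
  tsupport_subset := (tsupport_mul_subset_left).trans h.tsupport_subset

end IsTestFunction

section integrability

variable {b : ℝ} {f g : ℝ → ℂ}

theorem integrable_smul {a : ℝ → ℝ} (ha : ContinuousOn a (Icc b (b + 1)))
    (hf : Integrable f (intervalMeasure b)) :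
    Integrable (fun r => a r • f r) (intervalMeasure b) :=
  IntegrableOn.continuousOn_smul_of_subset ha hf isCompact_Icc measurableSet_Ioo
    Ioo_subset_Icc_self

theorem memLp_smul {a : ℝ → ℝ} (ha : ContinuousOn a (Icc b (b + 1)))
    (hf : MemLp f 2 (intervalMeasure b)) :
    MemLp (fun r => a r • f r) 2 (intervalMeasure b) := by
  obtain ⟨C, hC⟩ := isCompact_Icc.exists_bound_of_continuousOn ha
  refine MemLp.of_le_mul (c := C) hf
    (((ha.mono Ioo_subset_Icc_self).aestronglyMeasurable measurableSet_Ioo).smul hf.1) ?_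
  refine ae_restrict_of_forall_mem measurableSet_Ioo fun x hx => ?_
  rw [norm_smul]
  gcongr
  exact hC x (Ioo_subset_Icc_self hx)

theorem integrable_of_memLp (hf : MemLp f 2 (intervalMeasure b)) :
    Integrable f (intervalMeasure b) :=
  hf.integrable (by norm_num)

theorem memLp_of_continuousOn (hf : ContinuousOn f (Icc b (b + 1))) :
    MemLp f 2 (intervalMeasure b) := by
  obtain ⟨C, hC⟩ := isCompact_Icc.exists_bound_of_continuousOn hf
  exact MemLp.of_bound ((hf.mono Ioo_subset_Icc_self).aestronglyMeasurable measurableSet_Ioo) C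
    (ae_restrict_of_forall_mem measurableSet_Ioo fun x hx => hC x (Ioo_subset_Icc_self hx))

theorem Icc_subset_Ioi (hb : 0 < b) : Icc b (b + 1) ⊆ Ioi 0 := fun _ hx => hb.trans_le hx.1

end integrability

namespace HasWeakDeriv

variable {b : ℝ} {u v w z : ℝ → ℂ}

theorem congr_ae (h : HasWeakDeriv b u w) (hu : u =ᵐ[intervalMeasure b] v)
    (hw : w =ᵐ[intervalMeasure b] z) : HasWeakDeriv b v z := by
  intro φ h1 h2 h3
  have e1 : ∫ r in Ioo b (b + 1), deriv φ r • v r = ∫ r in Ioo b (b + 1), deriv φ r • u r :=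
    integral_congr_ae (hu.mono fun r hr => by simp only [hr])
  have e2 : ∫ r in Ioo b (b + 1), φ r • z r = ∫ r in Ioo b (b + 1), φ r • w r :=
    integral_congr_ae (hw.mono fun r hr => by simp only [hr])
  rw [e1, e2]
  exact h φ h1 h2 h3

theorem unique (h : HasWeakDeriv b u w) (h' : HasWeakDeriv b u z)
    (hw : Integrable w (intervalMeasure b)) (hz : Integrable z (intervalMeasure b)) :
    w =ᵐ[intervalMeasure b] z := by
  have key := isOpen_Ioo.ae_eq_zero_of_integral_contDiff_smul_eq_zero
    (f := fun r => w r - z r) (μ := volume) (U := Ioo b (b + 1))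
    (IntegrableOn.locallyIntegrableOn (hw.sub hz)) ?_
  · rw [← ae_restrict_iff' measurableSet_Ioo] at key
    filter_upwards [key] with r hr using sub_eq_zero.1 hr
  · intro φ h1 h2 h3
    have hc : ContinuousOn φ (Icc b (b + 1)) := h1.continuous.continuousOn
    have e1 := h φ h1 h2 h3
    rw [h' φ h1 h2 h3, neg_inj] at e1
    rw [← setIntegral_eq_integral_of_forall_compl_eq_zero (s := Ioo b (b + 1))]
    · simp only [smul_sub]
      rw [integral_sub (integrable_smul hc hw) (integrable_smul hc hz), e1, sub_self]
    · intro x hx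
      rw [image_eq_zero_of_notMem_tsupport fun hx' => hx (h3 hx'), zero_smul]

theorem sub (h : HasWeakDeriv b u w) (h' : HasWeakDeriv b v z)
    (hu : Integrable u (intervalMeasure b)) (hv : Integrable v (intervalMeasure b))
    (hw : Integrable w (intervalMeasure b)) (hz : Integrable z (intervalMeasure b)) :
    HasWeakDeriv b (fun r => u r - v r) (fun r => w r - z r) := by
  rw [hasWeakDeriv_iff] at *
  intro φ hφ
  have hc : ContinuousOn φ (Icc b (b + 1)) := hφ.continuous.continuousOn
  have hc' : ContinuousOn (deriv φ) (Icc b (b + 1)) := hφ.derivative.continuous.continuousOn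
  simp only [smul_sub]
  rw [integral_sub (integrable_smul hc hw) (integrable_smul hc hz),
    integral_sub (integrable_smul hc' hu) (integrable_smul hc' hv), h φ hφ, h' φ hφ]
  ring

theorem const_smul (h : HasWeakDeriv b u w) (c : ℝ) :
    HasWeakDeriv b (fun r => c • u r) (fun r => c • w r) := by
  rw [hasWeakDeriv_iff] at *
  intro φ hφ
  simp only [smul_comm _ c]
  rw [integral_smul, integral_smul, h φ hφ, smul_neg]

/-- The product rule for a factor that is smooth on `(0, ∞)`. -/
theorem smul_of_contDiffOn (h : HasWeakDeriv b u w) (hb : 0 < b)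
    (hu : Integrable u (intervalMeasure b)) (hw : Integrable w (intervalMeasure b)) {a : ℝ → ℝ}
    (ha : ContDiffOn ℝ ∞ a (Ioi 0)) :
    HasWeakDeriv b (fun r => a r • u r) (fun r => a r • w r + deriv a r • u r) := by
  rw [hasWeakDeriv_iff] at *
  intro φ hφ
  have hψ := hφ.mul_of_contDiffOn hb ha
  have hac : ContinuousOn a (Icc b (b + 1)) := ha.continuousOn.mono (Icc_subset_Ioi hb)
  have hac' : ContinuousOn (deriv a) (Icc b (b + 1)) :=
    (ha.continuousOn_deriv_of_isOpen isOpen_Ioi (by simp)).mono (Icc_subset_Ioi hb)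
  have hc : ContinuousOn φ (Icc b (b + 1)) := hφ.continuous.continuousOn
  have hc' : ContinuousOn (deriv φ) (Icc b (b + 1)) := hφ.derivative.continuous.continuousOn
  have key := h _ hψ
  have e1 : ∫ r in Ioo b (b + 1), deriv (fun r => φ r * a r) r • u r =
      (∫ r in Ioo b (b + 1), deriv φ r • a r • u r) +
        ∫ r in Ioo b (b + 1), φ r • deriv a r • u r := by
    rw [← integral_add (integrable_smul hc' (integrable_smul hac hu))
      (integrable_smul hc (integrable_smul hac' hu))]
    refine setIntegral_congr_fun measurableSet_Ioo fun r hr => ?_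
    have hd : DifferentiableAt ℝ a r :=
      (ha.contDiffAt (Ioi_mem_nhds (hb.trans hr.1))).differentiableAt (by simp)
    simp only [deriv_fun_mul (hφ.differentiable r) hd, add_smul, mul_smul]
  rw [e1] at key
  simp only [smul_add]
  rw [integral_add (integrable_smul hc (integrable_smul hac hw))
      (integrable_smul hc (integrable_smul hac' hu)), eq_sub_of_add_eq key]
  simp only [mul_smul]
  ring

end HasWeakDeriv

theorem contDiffOn_sqrt : ContDiffOn ℝ ∞ Real.sqrt (Ioi 0) :=
  contDiffOn_id.sqrt fun _ hx => ne_of_gt hx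

theorem contDiffOn_inv_sqrt : ContDiffOn ℝ ∞ (fun r => (Real.sqrt r)⁻¹) (Ioi 0) :=
  contDiffOn_sqrt.inv fun _ hx => (Real.sqrt_pos.2 hx).ne'

theorem continuousOn_inv_sqrt {b : ℝ} (hb : 0 < b) :
    ContinuousOn (fun r => (Real.sqrt r)⁻¹) (Icc b (b + 1)) :=
  contDiffOn_inv_sqrt.continuousOn.mono (Icc_subset_Ioi hb)

theorem div_sqrt_eq_smul (u : ℝ → ℂ) :
    (fun r => u r / (Real.sqrt r : ℂ)) = fun r => (Real.sqrt r)⁻¹ • u r := by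
  ext r
  rw [Complex.real_smul, Complex.ofReal_inv, div_eq_inv_mul]

section MemH1

variable {b : ℝ}

/-- Since `b > 0`, both `√r` and `1/√r` are smooth on the closed interval, so the product rule
passes between `u` and `u/√r`. This ensures that `groundStateDeriv` is a genuine weak derivative on
the form domain, not its default value `0`. -/
theorem memH1_iff (hb : 0 < b) (u : L2 b) :
    MemH1 b u ↔ ∃ z : ℝ → ℂ, MemLp z 2 (intervalMeasure b) ∧
      HasWeakDeriv b (fun r => u r / (Real.sqrt r : ℂ)) z := by
  have hu : MemLp u 2 (intervalMeasure b) := Lp.memLp u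
  have cont {a : ℝ → ℝ} (ha : ContDiffOn ℝ ∞ a (Ioi 0)) :
      ContinuousOn a (Icc b (b + 1)) ∧ ContinuousOn (deriv a) (Icc b (b + 1)) :=
    ⟨ha.continuousOn.mono (Icc_subset_Ioi hb),
      (ha.continuousOn_deriv_of_isOpen isOpen_Ioi (by simp)).mono (Icc_subset_Ioi hb)⟩
  rw [div_sqrt_eq_smul]
  constructor
  · rintro ⟨w, hw⟩
    have hwL : MemLp w 2 (intervalMeasure b) := Lp.memLp w
    obtain ⟨c1, c2⟩ := cont contDiffOn_inv_sqrt
    exact ⟨_, (memLp_smul c1 hwL).add (memLp_smul c2 hu), hw.smul_of_contDiffOn hb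
      (integrable_of_memLp hu) (integrable_of_memLp hwL) contDiffOn_inv_sqrt⟩
  · rintro ⟨z, hz, h⟩
    obtain ⟨c1, c2⟩ := cont contDiffOn_sqrt
    have hv := memLp_smul (cont contDiffOn_inv_sqrt).1 hu
    have hL := (memLp_smul c1 hz).add (memLp_smul c2 hv)
    refine ⟨hL.toLp _, (h.smul_of_contDiffOn hb (integrable_of_memLp hv) (integrable_of_memLp hz)
      contDiffOn_sqrt).congr_ae ?_ hL.coeFn_toLp.symm⟩
    refine ae_restrict_of_forall_mem measurableSet_Ioo fun x hx => ?_
    have : Real.sqrt x ≠ 0 := (Real.sqrt_pos.2 (hb.trans hx.1)).ne'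
    simp only [smul_smul, mul_inv_cancel₀ this, one_smul]

theorem groundStateDeriv_spec (hb : 0 < b) {u : L2 b} (hu : MemH1 b u) :
    MemLp (groundStateDeriv b u) 2 (intervalMeasure b) ∧
      HasWeakDeriv b (fun r => u r / (Real.sqrt r : ℂ)) (groundStateDeriv b u) := by
  have h := (memH1_iff hb u).1 hu
  unfold groundStateDeriv weakDeriv
  rw [dif_pos h]
  exact h.choose_spec

theorem groundStateDeriv_ae_eq (hb : 0 < b) {u : L2 b} {z : ℝ → ℂ}
    (hz : MemLp z 2 (intervalMeasure b))
    (h : HasWeakDeriv b (fun r => u r / (Real.sqrt r : ℂ)) z) :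
    groundStateDeriv b u =ᵐ[intervalMeasure b] z := by
  have hu := groundStateDeriv_spec hb ((memH1_iff hb u).2 ⟨z, hz, h⟩)
  exact hu.2.unique h (integrable_of_memLp hu.1) (integrable_of_memLp hz)

end MemH1

/-! ### Functions with an integrable weak derivative as primitives -/

section primitive

variable {b : ℝ}

theorem integral_Ioo_eq_interval {E : Type*} [NormedAddCommGroup E] [NormedSpace ℝ E]
    (b : ℝ) (f : ℝ → E) : ∫ r in Ioo b (b + 1), f r = ∫ r in b..(b + 1), f r := by
  rw [intervalIntegral.integral_of_le (by linarith), integral_Ioc_eq_integral_Ioo]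

theorem intervalIntegrable_of_integrable {E : Type*} [NormedAddCommGroup E] {f : ℝ → E}
    (hf : Integrable f (intervalMeasure b)) : IntervalIntegrable f volume b (b + 1) := by
  rw [intervalIntegrable_iff_integrableOn_Ioo_of_le (by linarith)]
  exact hf

theorem intervalIntegrable_of_mem_Icc {E : Type*} [NormedAddCommGroup E] {f : ℝ → E} {x y : ℝ}
    (hf : Integrable f (intervalMeasure b)) (hx : x ∈ Icc b (b + 1)) (hy : y ∈ Icc b (b + 1)) :
    IntervalIntegrable f volume x y :=
  (intervalIntegrable_of_integrable hf).mono_set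
    (by rw [uIcc_of_le (show b ≤ b + 1 by linarith)]; exact uIcc_subset_Icc hx hy)

/-- Integration by parts for absolutely continuous functions; the primitive has derivative `z`
almost everywhere and vanishes at `b`, so only the boundary term at `b + 1` survives. -/
theorem integral_deriv_mul_primitive {z : ℝ → ℝ} (hz : Integrable z (intervalMeasure b))
    {ψ : ℝ → ℝ} (hψ : ContDiff ℝ 1 ψ) :
    ∫ r in Ioo b (b + 1), deriv ψ r * (∫ t in b..r, z t) =
      ψ (b + 1) * (∫ t in b..(b + 1), z t) - ∫ r in Ioo b (b + 1), ψ r * z r := by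
  have hz' := intervalIntegrable_of_integrable hz
  have hV := hz'.absolutelyContinuousOnInterval_intervalIntegral (c := b) (by simp)
  have hψ' : AbsolutelyContinuousOnInterval ψ b (b + 1) :=
    hψ.contDiffOn.absolutelyContinuousOnInterval
  have h := hψ'.integral_mul_deriv_eq_deriv_mul hV
  rw [intervalIntegral.integral_same, mul_zero, sub_zero] at h
  have e : ∫ r in b..(b + 1), ψ r * deriv (fun x => ∫ t in b..x, z t) r =
      ∫ r in b..(b + 1), ψ r * z r := by
    refine intervalIntegral.integral_congr_ae ?_
    filter_upwards [hz'.ae_hasDerivAt_integral] with x hx hx'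
    rw [(hx (uIoc_subset_uIcc hx') b (by simp)).deriv]
  rw [e] at h
  rw [integral_Ioo_eq_interval, integral_Ioo_eq_interval, h]
  ring

theorem integrable_primitive_smul {z : ℝ → ℂ} (hz : Integrable z (intervalMeasure b))
    {a : ℝ → ℝ} (ha : Continuous a) :
    Integrable (fun r => a r • ∫ t in b..r, z t) (intervalMeasure b) := by
  have h : ContinuousOn (fun r => ∫ t in b..r, z t) (Icc b (b + 1)) :=
    intervalIntegral.continuousOn_primitive_interval'
      (intervalIntegrable_of_integrable hz) (by simp) |>.mono (by
        rw [uIcc_of_le (show b ≤ b + 1 by linarith)])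
  exact ((ha.continuousOn.smul h).integrableOn_Icc).mono_set Ioo_subset_Icc_self

theorem integral_deriv_smul_primitive {z : ℝ → ℂ} (hz : Integrable z (intervalMeasure b))
    {ψ : ℝ → ℝ} (hψ : ContDiff ℝ 1 ψ) :
    ∫ r in Ioo b (b + 1), deriv ψ r • (∫ t in b..r, z t) =
      ψ (b + 1) • (∫ t in b..(b + 1), z t) - ∫ r in Ioo b (b + 1), ψ r • z r := by
  have i1 := integrable_primitive_smul hz (hψ.continuous_deriv le_rfl)
  have i2 := integrable_smul hψ.continuous.continuousOn hz
  have aux (L : ℂ →L[ℝ] ℝ) : L (∫ r in Ioo b (b + 1), deriv ψ r • (∫ t in b..r, z t)) =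
      L (ψ (b + 1) • (∫ t in b..(b + 1), z t) - ∫ r in Ioo b (b + 1), ψ r • z r) := by
    rw [map_sub, ← L.integral_comp_comm i1, ← L.integral_comp_comm i2]
    simp only [map_smul, smul_eq_mul]
    have hLz : Integrable (fun r => L (z r)) (intervalMeasure b) := L.integrable_comp hz
    have e {x : ℝ} (hx : x ∈ Icc b (b + 1)) : L (∫ t in b..x, z t) = ∫ t in b..x, L (z t) :=
      (L.intervalIntegral_comp_comm
        (intervalIntegrable_of_mem_Icc hz (by simp) hx)).symm
    rw [e (by simp), ← integral_deriv_mul_primitive hLz hψ]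
    exact setIntegral_congr_fun measurableSet_Ioo fun r hr => by
      simp only [e (Ioo_subset_Icc_self hr)]
  exact Complex.ext (aux Complex.reCLM) (aux Complex.imCLM)

theorem hasWeakDeriv_primitive {z : ℝ → ℂ} (hz : Integrable z (intervalMeasure b)) :
    HasWeakDeriv b (fun r => ∫ t in b..r, z t) z := by
  rw [hasWeakDeriv_iff]
  intro φ hφ
  rw [integral_deriv_smul_primitive hz (hφ.contDiff.of_le (by simp)),
    hφ.apply_eq_zero (by simp), zero_smul, zero_sub]

end primitive

section constant

variable {b : ℝ}

theorem IsTestFunction.exists_primitive {g : ℝ → ℝ} (hg : IsTestFunction b g)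
    (h0 : ∫ r, g r = 0) : ∃ ψ, IsTestFunction b ψ ∧ deriv ψ = g := by
  have hd : ∀ x, HasDerivAt (fun x => ∫ t in b..x, g t) (g x) x := fun x =>
    intervalIntegral.integral_hasDerivAt_right (hg.continuous.intervalIntegrable _ _)
      (hg.continuous.stronglyMeasurableAtFilter _ _) hg.continuous.continuousAt
  have hd' : deriv (fun x => ∫ t in b..x, g t) = g := funext fun x => (hd x).deriv
  -- For empty support the choice `c = b + 1`, `d = b` makes `Icc c d` empty.
  obtain ⟨c, d, hc, hcd, hK⟩ : ∃ c d, b < c ∧ d < b + 1 ∧ tsupport g ⊆ Icc c d := by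
    rcases (tsupport g).eq_empty_or_nonempty with h | h
    · exact ⟨b + 1, b, by linarith, by linarith, by simp [h]⟩
    · obtain ⟨c, hc⟩ := hg.hasCompactSupport.isCompact.exists_isLeast h
      obtain ⟨d, hd⟩ := hg.hasCompactSupport.isCompact.exists_isGreatest h
      exact ⟨c, d, (hg.tsupport_subset hc.1).1, (hg.tsupport_subset hd.1).2,
        fun x hx => ⟨hc.2 hx, hd.2 hx⟩⟩
  have hs : tsupport (fun x => ∫ t in b..x, g t) ⊆ Icc c d := by
    refine closure_minimal (fun x hx => ?_) isClosed_Icc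
    by_contra hx'
    apply hx
    rcases lt_or_ge x c with h | h
    · refine (intervalIntegral.integral_congr fun t ht => ?_).trans
        intervalIntegral.integral_zero
      refine image_eq_zero_of_notMem_tsupport fun ht' => ?_
      exact absurd (hK ht').1 (not_le.2 (ht.2.trans_lt (max_lt hc h)))
    · have hdx : d < x := by
        by_contra hh
        exact hx' ⟨h, not_lt.1 hh⟩
      change ∫ t in b..x, g t = 0
      rw [intervalIntegral.integral_eq_integral_of_support_subset, h0]
      intro t ht
      have := hK (subset_tsupport g ht)
      exact ⟨hc.trans_le this.1, this.2.trans hdx.le⟩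
  refine ⟨_, ⟨?_, HasCompactSupport.of_support_subset_isCompact isCompact_Icc
    ((subset_tsupport _).trans hs), hs.trans (Icc_subset_Ioo hc hcd)⟩, hd'⟩
  rw [contDiff_infty_iff_deriv, hd']
  exact ⟨fun x => (hd x).differentiableAt, hg.contDiff⟩

theorem exists_isTestFunction_integral_eq_one (b : ℝ) :
    ∃ η, IsTestFunction b η ∧ ∫ r, η r = 1 := by
  let f : ContDiffBump (b + 1 / 2) := ⟨1 / 8, 1 / 4, by norm_num, by norm_num⟩
  refine ⟨f.normed volume, ⟨f.contDiff_normed, f.hasCompactSupport_normed, ?_⟩, f.integral_normed⟩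
  rw [f.tsupport_normed_eq, Real.closedBall_eq_Icc]
  exact Icc_subset_Ioo (by norm_num [f]; linarith) (by norm_num [f]; linarith)

theorem IsTestFunction.integral_eq_setIntegral {φ : ℝ → ℝ} (hφ : IsTestFunction b φ) :
    ∫ r in Ioo b (b + 1), φ r = ∫ r, φ r :=
  setIntegral_eq_integral_of_forall_compl_eq_zero fun _ hx => hφ.apply_eq_zero hx

/-- The du Bois-Reymond argument: subtracting from `φ` its integral times a fixed bump `η` of
integral one leaves the derivative of a test function, against which `u` integrates to zero. Hence
`u` equals its `η`-average, which is also its mean because the interval has length one. -/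
theorem HasWeakDeriv.ae_eq_const {u : ℝ → ℂ} (h : HasWeakDeriv b u 0)
    (hu : Integrable u (intervalMeasure b)) :
    u =ᵐ[intervalMeasure b] fun _ => ∫ r in Ioo b (b + 1), u r := by
  obtain ⟨η, hη, hη1⟩ := exists_isTestFunction_integral_eq_one b
  rw [hasWeakDeriv_iff] at h
  set d : ℂ := ∫ r in Ioo b (b + 1), η r • u r with hd
  have hci : Integrable (fun _ : ℝ => d) (intervalMeasure b) := integrable_const d
  have key : u =ᵐ[intervalMeasure b] fun _ => d := by
    have := isOpen_Ioo.ae_eq_zero_of_integral_contDiff_smul_eq_zero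
      (f := fun r => u r - d) (μ := volume) (U := Ioo b (b + 1))
      (IntegrableOn.locallyIntegrableOn (hu.sub hci)) ?_
    · rw [← ae_restrict_iff' measurableSet_Ioo] at this
      filter_upwards [this] with r hr using sub_eq_zero.1 hr
    · intro φ h1 h2 h3
      have hφ : IsTestFunction b φ := ⟨h1, h2, h3⟩
      have hg : IsTestFunction b (fun r => φ r - (∫ s, φ s) * η r) :=
        ⟨h1.sub (contDiff_const.mul hη.contDiff), h2.sub hη.hasCompactSupport.mul_left,
          (tsupport_sub _ _).trans (union_subset h3
            (tsupport_mul_subset_right.trans hη.tsupport_subset))⟩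
      have hφi : Integrable φ volume := h1.continuous.integrable_of_hasCompactSupport h2
      have hηi : Integrable η volume :=
        hη.continuous.integrable_of_hasCompactSupport hη.hasCompactSupport
      obtain ⟨ψ, hψ, hψ'⟩ := hg.exists_primitive (by
        rw [integral_sub hφi (hηi.const_mul _), integral_const_mul, hη1, mul_one, sub_self])
      have e := h ψ hψ
      simp only [hψ', Pi.zero_apply, smul_zero, integral_zero, neg_zero, sub_smul, mul_smul] at e
      have i1 := integrable_smul (b := b) h1.continuous.continuousOn hu
      have i2 := integrable_smul (b := b) hη.continuous.continuousOn hu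
      have i3 := integrable_smul (b := b) h1.continuous.continuousOn hci
      have i4 : Integrable (fun r => (∫ s, φ s) • η r • u r) (intervalMeasure b) :=
        integrable_smul (a := fun _ => ∫ s, φ s) continuousOn_const i2
      rw [integral_sub i1 i4, integral_smul, ← hd] at e
      rw [← setIntegral_eq_integral_of_forall_compl_eq_zero (s := Ioo b (b + 1)) fun x hx => by
        rw [hφ.apply_eq_zero hx, zero_smul]]
      simp only [smul_sub]
      rw [integral_sub i1 i3, integral_smul_const, hφ.integral_eq_setIntegral, e]
  have : ∫ r in Ioo b (b + 1), u r = d := by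
    rw [integral_congr_ae key, integral_const]
    simp [Measure.real]
  rwa [this]

/-- A function with an integrable weak derivative, recovered from its mean value and the weak
derivative. -/
theorem HasWeakDeriv.ae_eq_primitive {v z : ℝ → ℂ} (h : HasWeakDeriv b v z)
    (hv : Integrable v (intervalMeasure b)) (hz : Integrable z (intervalMeasure b)) :
    v =ᵐ[intervalMeasure b] fun r => (∫ s in Ioo b (b + 1), v s) -
      (∫ s in Ioo b (b + 1), (b + 1 - s) • z s) + ∫ t in b..r, z t := by
  have hV : Integrable (fun r => ∫ t in b..r, z t) (intervalMeasure b) := by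
    simpa using integrable_primitive_smul hz (a := fun _ => 1) continuous_const
  have h0 := h.sub (hasWeakDeriv_primitive hz) hv hV hz hz
  have h1 := (h0.congr_ae (Filter.EventuallyEq.refl _ _)
    (z := 0) (by simp; rfl)).ae_eq_const (hv.sub hV)
  -- The factor `s - (b + 1)` has derivative one and vanishes at the right end, so this computes the
  -- mean of the primitive as `∫ (b + 1 - s) z`.
  have e := integral_deriv_smul_primitive hz (ψ := fun s => s - (b + 1))
    (contDiff_id.sub contDiff_const)
  simp only [deriv_sub_const, deriv_id'', one_smul, sub_self, zero_smul, zero_sub] at e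
  rw [← integral_neg] at e
  simp only [← neg_smul, neg_sub] at e
  filter_upwards [h1] with r hr
  rw [integral_sub hv hV, e] at hr
  rw [← hr]
  ring

end constant

/-! ### Riccati lower bounds for the energy -/

section energy

variable {x y k : ℝ} {q q' : ℝ → ℝ}

/-- The function `q V²` is absolutely continuous, so its increment is the integral of its
derivative, and that derivative is at most the energy density almost everywhere. -/
theorem riccati_real_le (hx : 0 < x) (hxy : x ≤ y) (hq : ContDiffOn ℝ 1 q (Icc x y))
    (hd : ∀ ρ ∈ Ioo x y, HasDerivAt q (q' ρ) ρ)
    (hr : ∀ ρ ∈ Ioo x y, q' ρ + q ρ ^ 2 / ρ ≤ k ^ 2 * ρ) {V z : ℝ → ℝ}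
    (hz : IntervalIntegrable z volume x y)
    (hz2 : IntervalIntegrable (fun ρ => z ρ ^ 2) volume x y)
    (hV : ∀ ρ ∈ Icc x y, V ρ = V x + ∫ t in x..ρ, z t) :
    q y * V y ^ 2 - q x * V x ^ 2 ≤ ∫ ρ in x..y, (z ρ ^ 2 + k ^ 2 * V ρ ^ 2) * ρ := by
  set W : ℝ → ℝ := fun ρ => V x + ∫ t in x..ρ, z t with hW
  have hWac : AbsolutelyContinuousOnInterval W x y :=
    AbsolutelyContinuousOnInterval.add
      (contDiffOn_const (c := V x)).absolutelyContinuousOnInterval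
      (hz.absolutelyContinuousOnInterval_intervalIntegral (c := x) (by simp))
  have hqac : AbsolutelyContinuousOnInterval q x y := by
    refine ContDiffOn.absolutelyContinuousOnInterval ?_
    rwa [uIcc_of_le hxy]
  have hF : AbsolutelyContinuousOnInterval (fun ρ => q ρ * (W ρ * W ρ)) x y :=
    hqac.fun_mul (hWac.fun_mul hWac)
  have hWc : ContinuousOn W (Icc x y) := by
    have := hWac.continuousOn
    rwa [uIcc_of_le hxy] at this
  have e1 : ∫ ρ in x..y, (z ρ ^ 2 + k ^ 2 * V ρ ^ 2) * ρ =
      ∫ ρ in x..y, (z ρ ^ 2 + k ^ 2 * W ρ ^ 2) * ρ := by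
    refine intervalIntegral.integral_congr fun ρ hρ => ?_
    rw [uIcc_of_le hxy] at hρ
    simp only [hW, hV ρ hρ]
  have e2 := hF.integral_deriv_eq_sub
  have hWx : W x = V x := by simp [hW]
  have hWy : W y = V y := (hV y ⟨hxy, le_rfl⟩).symm
  rw [hWx, hWy] at e2
  rw [e1, sq, sq, ← e2]
  refine intervalIntegral.integral_mono_ae_restrict hxy hF.intervalIntegrable_deriv ?_ ?_
  · refine IntervalIntegrable.mul_continuousOn (hz2.add ?_) continuousOn_id
    refine ContinuousOn.intervalIntegrable ?_
    rw [uIcc_of_le hxy]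
    exact continuousOn_const.mul (hWc.pow 2)
  · rw [Filter.EventuallyLE, ← restrict_Ioo_eq_restrict_Icc, ae_restrict_iff' measurableSet_Ioo]
    filter_upwards [hz.ae_hasDerivAt_integral] with ρ hρ hρ'
    have hρ0 : 0 < ρ := hx.trans hρ'.1
    have hWd : HasDerivAt W (z ρ) ρ := by
      have := hρ (by rw [uIcc_of_le hxy]; exact Ioo_subset_Icc_self hρ') x (by simp)
      simpa [hW] using this.const_add (V x)
    rw [((hd ρ hρ').fun_mul (hWd.fun_mul hWd)).deriv]
    have h1 := mul_le_mul_of_nonneg_right (hr ρ hρ') (sq_nonneg (W ρ))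
    -- This square absorbs the cross term `2 q W z` of `(q W²)'`; the remaining `(q' + q²/ρ) W²` is
    -- controlled by the Riccati inequality.
    have h2 : 0 ≤ (ρ * z ρ - q ρ * W ρ) ^ 2 / ρ := by positivity
    have h3 : (ρ * z ρ - q ρ * W ρ) ^ 2 / ρ =
        ρ * z ρ ^ 2 - 2 * q ρ * W ρ * z ρ + q ρ ^ 2 / ρ * W ρ ^ 2 := by
      field_simp
      ring
    nlinarith

/-- A subsolution `q` of the Riccati equation `q' + q² / ρ = k² ρ` bounds the energy of `V` from
below by boundary terms. -/
theorem riccati_le (hx : 0 < x) (hxy : x ≤ y) (hq : ContDiffOn ℝ 1 q (Icc x y))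
    (hd : ∀ ρ ∈ Ioo x y, HasDerivAt q (q' ρ) ρ)
    (hr : ∀ ρ ∈ Ioo x y, q' ρ + q ρ ^ 2 / ρ ≤ k ^ 2 * ρ) {V z : ℝ → ℂ}
    (hz : IntervalIntegrable z volume x y)
    (hz2 : IntervalIntegrable (fun ρ => ‖z ρ‖ ^ 2) volume x y)
    (hV : ∀ ρ ∈ Icc x y, V ρ = V x + ∫ t in x..ρ, z t) :
    q y * ‖V y‖ ^ 2 - q x * ‖V x‖ ^ 2 ≤
      ∫ ρ in x..y, (‖z ρ‖ ^ 2 + k ^ 2 * ‖V ρ‖ ^ 2) * ρ := by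
  have hVc : ContinuousOn V (Icc x y) := by
    have : ContinuousOn (fun ρ => V x + ∫ t in x..ρ, z t) (Icc x y) := by
      have := intervalIntegral.continuousOn_primitive_interval' hz left_mem_uIcc
      rw [uIcc_of_le hxy] at this
      exact continuousOn_const.add this
    exact this.congr hV
  -- Energy and boundary terms split into real and imaginary parts, so the real case is applied to
  -- each.
  have aux (L : ℂ →L[ℝ] ℝ) (hL : ∀ c, ‖L c‖ ≤ ‖c‖) :
      IntervalIntegrable (fun ρ => (L (z ρ) ^ 2 + k ^ 2 * L (V ρ) ^ 2) * ρ) volume x y ∧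
      q y * L (V y) ^ 2 - q x * L (V x) ^ 2 ≤
        ∫ ρ in x..y, (L (z ρ) ^ 2 + k ^ 2 * L (V ρ) ^ 2) * ρ := by
    have hLz : IntervalIntegrable (fun ρ => L (z ρ)) volume x y :=
      ⟨L.integrable_comp hz.1, L.integrable_comp hz.2⟩
    have hLz2 : IntervalIntegrable (fun ρ => L (z ρ) ^ 2) volume x y := by
      refine hz2.mono_fun (hLz.aestronglyMeasurable_restrict_uIoc.pow 2) ?_
      refine Filter.Eventually.of_forall fun ρ => ?_
      simp only [norm_pow, norm_norm]
      gcongr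
      exact hL _
    refine ⟨?_, riccati_real_le hx hxy hq hd hr hLz hLz2 (V := fun ρ => L (V ρ))
      fun ρ hρ => ?_⟩
    · refine IntervalIntegrable.mul_continuousOn (hLz2.add ?_) continuousOn_id
      refine ContinuousOn.intervalIntegrable ?_
      rw [uIcc_of_le hxy]
      exact continuousOn_const.mul ((L.continuous.comp_continuousOn hVc).pow 2)
    · have hs : IntervalIntegrable z volume x ρ :=
        hz.mono_set (by rw [uIcc_of_le hxy, uIcc_of_le hρ.1]; exact Icc_subset_Icc_right hρ.2)
      simp only [hV ρ hρ, map_add, L.intervalIntegral_comp_comm hs]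
  obtain ⟨i1, h1⟩ := aux Complex.reCLM fun c => Complex.abs_re_le_norm c
  obtain ⟨i2, h2⟩ := aux Complex.imCLM fun c => Complex.abs_im_le_norm c
  simp only [Complex.reCLM_apply, Complex.imCLM_apply] at i1 i2 h1 h2
  have hn (c : ℂ) : ‖c‖ ^ 2 = c.re ^ 2 + c.im ^ 2 := by
    rw [Complex.sq_norm, Complex.normSq_apply]; ring
  have e : ∫ ρ in x..y, (‖z ρ‖ ^ 2 + k ^ 2 * ‖V ρ‖ ^ 2) * ρ =
      (∫ ρ in x..y, ((z ρ).re ^ 2 + k ^ 2 * (V ρ).re ^ 2) * ρ) +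
        ∫ ρ in x..y, ((z ρ).im ^ 2 + k ^ 2 * (V ρ).im ^ 2) * ρ := by
    rw [← intervalIntegral.integral_add i1 i2]
    refine intervalIntegral.integral_congr fun ρ _ => ?_
    simp only [hn]
    ring
  rw [e, hn, hn]
  linarith

end energy

/-! ### From energy bounds to the diagonal of the Green function -/

section greenBound

variable {b k : ℝ}

/-- Testing the form equation with `u` itself gives `h_b[u] + k²‖u‖² = ⟨u, f⟩`; `V` is the
continuous representative of `u/√r`. -/
theorem operatorGraph_energy (hb : 0 < b) {u f : L2 b}
    (h : OperatorGraph b u (f - ((k ^ 2 : ℝ) : ℂ) • u)) :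
    ∃ V z : ℝ → ℂ, MemLp z 2 (intervalMeasure b) ∧
      (∀ ρ, V ρ = V b + ∫ t in b..ρ, z t) ∧
      (u =ᵐ[intervalMeasure b] fun r => (Real.sqrt r : ℂ) * V r) ∧
      ∫ ρ in Ioo b (b + 1), (‖z ρ‖ ^ 2 + k ^ 2 * ‖V ρ‖ ^ 2) * ρ = (inner ℂ u f).re := by
  obtain ⟨hz, hd⟩ := groundStateDeriv_spec hb h.1
  set z := groundStateDeriv b u with hzdef
  have hu : MemLp u 2 (intervalMeasure b) := Lp.memLp u
  have hv : MemLp (fun r => u r / (Real.sqrt r : ℂ)) 2 (intervalMeasure b) := by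
    rw [div_sqrt_eq_smul]
    exact memLp_smul (continuousOn_inv_sqrt hb) hu
  have hrep := hd.ae_eq_primitive (integrable_of_memLp hv) (integrable_of_memLp hz)
  set A : ℂ := (∫ s in Ioo b (b + 1), u s / (Real.sqrt s : ℂ)) -
    ∫ s in Ioo b (b + 1), (b + 1 - s) • z s
  have huV : u =ᵐ[intervalMeasure b]
      fun r => (Real.sqrt r : ℂ) * (A + ∫ t in b..r, z t) := by
    filter_upwards [hrep, ae_restrict_mem measurableSet_Ioo] with r hr hr'
    have : (Real.sqrt r : ℂ) ≠ 0 := by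
      exact_mod_cast (Real.sqrt_pos.2 (hb.trans hr'.1)).ne'
    rw [← hr, mul_div_cancel₀ _ this]
  refine ⟨fun r => A + ∫ t in b..r, z t, z, hz, fun ρ => by simp, huV, ?_⟩
  have hform := h.2 u h.1
  rw [inner_sub_right, inner_smul_right] at hform
  have e1 : form b u u = ((∫ ρ in Ioo b (b + 1), ‖z ρ‖ ^ 2 * ρ : ℝ) : ℂ) := by
    unfold form
    rw [← integral_complex_ofReal]
    refine setIntegral_congr_fun measurableSet_Ioo fun r _ => ?_
    simp only [← hzdef, Complex.conj_mul', Complex.ofReal_mul, Complex.ofReal_pow]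
  have e2 : (inner ℂ u u : ℂ) = ((∫ ρ in Ioo b (b + 1), ‖u ρ‖ ^ 2 : ℝ) : ℂ) := by
    rw [L2.inner_def, ← integral_complex_ofReal]
    refine setIntegral_congr_fun measurableSet_Ioo fun r _ => ?_
    simp only [inner_self_eq_norm_sq_to_K]
    simp
  have e3 : ∫ ρ in Ioo b (b + 1), ‖u ρ‖ ^ 2 =
      ∫ ρ in Ioo b (b + 1), ‖A + ∫ t in b..ρ, z t‖ ^ 2 * ρ := by
    refine integral_congr_ae ?_
    filter_upwards [huV, ae_restrict_mem measurableSet_Ioo] with r hr hr'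
    rw [hr, norm_mul, mul_pow, Complex.norm_real, Real.norm_eq_abs, sq_abs,
      Real.sq_sqrt (hb.trans hr'.1).le, mul_comm]
  have i1 : Integrable (fun ρ => ‖z ρ‖ ^ 2 * ρ) (intervalMeasure b) := by
    have h2 : IntegrableOn (fun ρ => ‖z ρ‖ ^ 2) (Ioo b (b + 1)) volume :=
      (memLp_two_iff_integrable_sq_norm hz.1).1 hz
    exact IntegrableOn.mul_continuousOn_of_subset h2 (K := Icc b (b + 1)) continuousOn_id
      measurableSet_Ioo isCompact_Icc Ioo_subset_Icc_self
  have i2 : Integrable (fun ρ => ‖A + ∫ t in b..ρ, z t‖ ^ 2 * ρ) (intervalMeasure b) := by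
    refine ((memLp_two_iff_integrable_sq_norm hu.1).1 hu).congr ?_
    filter_upwards [huV, ae_restrict_mem measurableSet_Ioo] with r hr hr'
    rw [hr, norm_mul, mul_pow, Complex.norm_real, Real.norm_eq_abs, sq_abs,
      Real.sq_sqrt (hb.trans hr'.1).le, mul_comm]
  have e4 : ∫ ρ in Ioo b (b + 1), (‖z ρ‖ ^ 2 + k ^ 2 * ‖A + ∫ t in b..ρ, z t‖ ^ 2) * ρ =
      (∫ ρ in Ioo b (b + 1), ‖z ρ‖ ^ 2 * ρ) +
        k ^ 2 * ∫ ρ in Ioo b (b + 1), ‖A + ∫ t in b..ρ, z t‖ ^ 2 * ρ := by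
    rw [← integral_const_mul, ← integral_add i1 (i2.const_mul _)]
    refine setIntegral_congr_fun measurableSet_Ioo fun r _ => ?_
    ring
  rw [e4, ← e3]
  rw [e1, e2, eq_sub_iff_add_eq] at hform
  rw [← hform, ← Complex.ofReal_mul, ← Complex.ofReal_add, Complex.ofReal_re]

theorem norm_average_sub_le {lo hi ε : ℝ} (hlt : lo < hi) {h : ℝ → ℂ} {g : ℂ}
    (hi' : IntegrableOn h (Ioo lo hi))
    (hh : ∀ᵐ s ∂volume.restrict (Ioo lo hi), ‖h s - g‖ ≤ ε) :
    ‖((hi - lo)⁻¹ : ℂ) * (∫ s in Ioo lo hi, h s) - g‖ ≤ ε := by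
  have := (convex_closedBall g ε).set_average_mem Metric.isClosed_closedBall
    (μ := volume) (t := Ioo lo hi) (f := h) (by simp [hlt]) (by simp)
    (by simpa only [Metric.mem_closedBall, dist_eq_norm] using hh) hi'
  rw [setAverage_eq, Metric.mem_closedBall, dist_eq_norm] at this
  simpa [Measure.real, hlt.le] using this

theorem norm_sub_le_of_ae {lo hi ε : ℝ} (hlt : lo < hi) {F : ℝ → ℂ} {g : ℂ}
    (hF : ContinuousOn F (Icc lo hi))
    (hh : ∀ᵐ s ∂volume.restrict (Ioo lo hi), ‖F s - g‖ ≤ ε) :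
    ∀ s ∈ Icc lo hi, ‖F s - g‖ ≤ ε := by
  have := Measure.eqOn_Icc_of_ae_eq volume hlt.ne (f := fun s => max ‖F s - g‖ ε)
    (g := fun _ => ε) (by
      rw [← restrict_Ioo_eq_restrict_Icc]
      exact hh.mono fun s hs => max_eq_right hs)
    ((hF.sub continuousOn_const).norm.sup continuousOn_const) continuousOn_const
  exact fun s hs => max_eq_right_iff.1 (this hs)

/-- The resolvent is applied to an approximate delta `f` at `r`. With `g = G(r,r)`, continuity of
`G` puts `u = R f` within `ε` of `g` near `r`, so the energy `⟨u, f⟩` is at most `g + ε` while `r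
|V(r)|² = |u(r)|² ≥ (g - ε)²`. Hence `κ (g - ε)² ≤ r (g + ε)`, and `ε → 0` gives `κ g² ≤ r g`. -/
theorem IsGreenFunction.diagonal_le (hb : 0 < b) {G : ℝ → ℝ → ℝ}
    (hG : IsGreenFunction b k G) {r κ : ℝ} (hr : r ∈ Icc b (b + 1)) (hκ : 0 < κ)
    (hbound : ∀ V z : ℝ → ℂ, MemLp z 2 (intervalMeasure b) →
      (∀ ρ, V ρ = V b + ∫ t in b..ρ, z t) →
      κ * ‖V r‖ ^ 2 ≤ ∫ ρ in Ioo b (b + 1), (‖z ρ‖ ^ 2 + k ^ 2 * ‖V ρ‖ ^ 2) * ρ) :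
    G r r ≤ r / κ := by
  have hr0 : 0 < r := hb.trans_le hr.1
  obtain ⟨R, hR, hker⟩ := hG.kernel
  by_contra! hcon
  set g := G r r with hg
  have hg0 : 0 < g := (div_pos hr0 hκ).trans hcon
  have key : ∀ ε ∈ Ioo 0 g, κ * (g - ε) ^ 2 ≤ r * (g + ε) := by
    intro ε hε
    obtain ⟨δ, hδ0, hδ1, hδ⟩ : ∃ δ > 0, δ < 1 ∧ ∀ x ∈ Icc b (b + 1), ∀ y ∈ Icc b (b + 1),
        |x - r| ≤ δ → |y - r| ≤ δ → |G x y - g| ≤ ε := by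
      obtain ⟨δ, hδ, h⟩ := Metric.continuousWithinAt_iff.1
        (hG.continuousOn (r, r) ⟨hr, hr⟩) ε hε.1
      refine ⟨min (δ / 2) (1 / 2), by positivity, by
        exact (min_le_right _ _).trans_lt (by norm_num), fun x hx y hy hxr hyr => ?_⟩
      have h2 : min (δ / 2) (1 / 2) < δ := (min_le_left _ _).trans_lt (by linarith)
      have := h (x := (x, y)) ⟨hx, hy⟩ (by
        rw [Prod.dist_eq, max_lt_iff]
        exact ⟨by simpa [Real.dist_eq] using hxr.trans_lt h2,
          by simpa [Real.dist_eq] using hyr.trans_lt h2⟩)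
      exact this.le
    -- The image of `[b, b + 1]` under the contraction towards `r` with ratio `δ`: it has length
    -- exactly `δ` and stays inside the interval even when `r` is an endpoint.
    set lo := r - δ * (r - b) with hlo
    set hi := r + δ * (b + 1 - r) with hhi
    have hlen : hi - lo = δ := by rw [hlo, hhi]; ring
    have hlt : lo < hi := by linarith
    have p1 : 0 ≤ δ * (r - b) := mul_nonneg hδ0.le (by linarith [hr.1])
    have p2 : 0 ≤ δ * (b + 1 - r) := mul_nonneg hδ0.le (by linarith [hr.2])
    have p3 : 0 ≤ (1 - δ) * (r - b) := mul_nonneg (by linarith) (by linarith [hr.1])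
    have p4 : 0 ≤ (1 - δ) * (b + 1 - r) := mul_nonneg (by linarith) (by linarith [hr.2])
    have hrJ : r ∈ Icc lo hi := ⟨by linarith, by linarith⟩
    have hlob : b ≤ lo := by nlinarith
    have hhib : hi ≤ b + 1 := by nlinarith
    have hJI : Icc lo hi ⊆ Icc b (b + 1) := Icc_subset_Icc hlob hhib
    have hJI' : Ioo lo hi ⊆ Ioo b (b + 1) := Ioo_subset_Ioo hlob hhib
    have hnear : ∀ x ∈ Icc lo hi, |x - r| ≤ δ := by
      intro x hx
      have hb1 : δ * (r - b) ≤ δ := by nlinarith [hr.2]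
      have hb2 : δ * (b + 1 - r) ≤ δ := by nlinarith [hr.1]
      rw [abs_le]
      exact ⟨by linarith [hx.1], by linarith [hx.2]⟩
    have hvol : intervalMeasure b (Ioo lo hi) ≠ ⊤ := measure_ne_top _ _
    set f : L2 b := indicatorConstLp 2 (measurableSet_Ioo (a := lo) (b := hi)) hvol
      ((δ : ℂ)⁻¹) with hf
    have hrestr : (intervalMeasure b).restrict (Ioo lo hi) = volume.restrict (Ioo lo hi) := by
      rw [Measure.restrict_restrict measurableSet_Ioo, inter_eq_left.2 hJI']
    have hU : ∀ᵐ x ∂volume.restrict (Ioo lo hi), ‖R f x - (g : ℂ)‖ ≤ ε := by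
      have h1 := ae_mono (Measure.restrict_mono hJI' le_rfl) (hker f)
      filter_upwards [h1, ae_restrict_mem measurableSet_Ioo] with x hx hxJ
      have e1 : ∫ s in Ioo b (b + 1), (G x s : ℂ) * f s =
          ((hi - lo : ℂ))⁻¹ * ∫ s in Ioo lo hi, (G x s : ℂ) := by
        have : ∀ᵐ s ∂intervalMeasure b, (G x s : ℂ) * f s =
            (Ioo lo hi).indicator (fun s => (δ : ℂ)⁻¹ * (G x s : ℂ)) s := by
          filter_upwards [indicatorConstLp_coeFn (p := 2) (hs := measurableSet_Ioo)
            (hμs := hvol) (c := ((δ : ℂ)⁻¹))] with s hs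
          rw [hf, hs]
          by_cases hs' : s ∈ Ioo lo hi
          · simp only [indicator_of_mem hs']; ring
          · simp only [indicator_of_notMem hs', mul_zero]
        rw [integral_congr_ae this, integral_indicator measurableSet_Ioo, hrestr,
          integral_const_mul, ← hlen]
        push_cast
        rfl
      rw [hx, e1]
      have hxI := hJI (Ioo_subset_Icc_self hxJ)
      have hcont : ContinuousOn (fun s => (G x s : ℂ)) (Icc lo hi) := by
        refine Complex.continuous_ofReal.comp_continuousOn ?_
        exact hG.continuousOn.comp (f := fun s => (x, s)) (by fun_prop)
          fun s hs => ⟨hxI, hJI hs⟩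
      refine norm_average_sub_le hlt (hcont.integrableOn_Icc.mono_set Ioo_subset_Icc_self) ?_
      refine ae_restrict_of_forall_mem measurableSet_Ioo fun s hs => ?_
      rw [← Complex.ofReal_sub, Complex.norm_real]
      exact hδ x hxI s (hJI (Ioo_subset_Icc_self hs)) (hnear x (Ioo_subset_Icc_self hxJ))
        (hnear s (Ioo_subset_Icc_self hs))
    obtain ⟨V, z, hz, hV, huV, hE⟩ := operatorGraph_energy hb (hR.1 f)
    have hVc : ContinuousOn V (Icc b (b + 1)) := by
      have h1 : ContinuousOn (fun ρ => ∫ t in b..ρ, z t) (Icc b (b + 1)) := by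
        have := intervalIntegral.continuousOn_primitive_interval'
          (intervalIntegrable_of_integrable (integrable_of_memLp hz)) left_mem_uIcc
        rwa [uIcc_of_le (by linarith)] at this
      exact (continuousOn_const.add h1).congr fun ρ _ => hV ρ
    have hVr : ‖(Real.sqrt r : ℂ) * V r - g‖ ≤ ε := by
      refine norm_sub_le_of_ae hlt (F := fun ρ => (Real.sqrt ρ : ℂ) * V ρ) ?_ ?_ r hrJ
      · exact (Complex.continuous_ofReal.comp Real.continuous_sqrt).continuousOn.mul
          (hVc.mono hJI)
      · filter_upwards [hU, ae_mono (Measure.restrict_mono hJI' le_rfl) huV] with x h1 h2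
        rwa [← h2]
    have hin : (inner ℂ (R f) f : ℂ).re ≤ g + ε := by
      have hint : IntegrableOn (fun x => R f x) (Ioo lo hi) :=
        (show IntegrableOn (fun x => R f x) (Ioo b (b + 1)) volume from
          integrable_of_memLp (Lp.memLp (R f))).mono_set hJI'
      have e1 : (inner ℂ f (R f) : ℂ) = ((hi - lo : ℂ))⁻¹ * ∫ s in Ioo lo hi, R f s := by
        rw [hf, L2.inner_indicatorConstLp_eq_inner_setIntegral, hrestr, ← Complex.ofReal_sub,
          hlen]
        simp [mul_comm]
      have e2 := norm_average_sub_le hlt hint hU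
      rw [← e1] at e2
      rw [← inner_conj_symm, Complex.conj_re]
      have e3 := (Complex.re_le_norm _).trans e2
      rw [Complex.sub_re, Complex.ofReal_re] at e3
      linarith
    have h1 := hbound V z hz hV
    rw [hE] at h1
    have h2 : (g - ε) ^ 2 ≤ r * ‖V r‖ ^ 2 := by
      have e : r * ‖V r‖ ^ 2 = ‖(Real.sqrt r : ℂ) * V r‖ ^ 2 := by
        rw [norm_mul, mul_pow, Complex.norm_real, Real.norm_eq_abs, sq_abs, Real.sq_sqrt hr0.le]
      rw [e]
      refine pow_le_pow_left₀ (by linarith [hε.2]) ?_ 2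
      have := norm_sub_norm_le (g : ℂ) ((Real.sqrt r : ℂ) * V r)
      rw [norm_sub_rev, Complex.norm_real, Real.norm_eq_abs, abs_of_pos hg0] at this
      linarith
    calc κ * (g - ε) ^ 2 ≤ κ * (r * ‖V r‖ ^ 2) := by gcongr
      _ = r * (κ * ‖V r‖ ^ 2) := by ring
      _ ≤ r * (g + ε) := by gcongr; linarith
  have hlim : κ * (g - 0) ^ 2 ≤ r * (g + 0) := by
    refine le_of_tendsto_of_tendsto (b := nhdsWithin (0 : ℝ) (Ioi 0))
      (f := fun ε => κ * (g - ε) ^ 2) (g := fun ε => r * (g + ε)) ?_ ?_ ?_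
    · exact ((by fun_prop : Continuous fun ε => κ * (g - ε) ^ 2).tendsto 0).mono_left
        nhdsWithin_le_nhds
    · exact ((by fun_prop : Continuous fun ε => r * (g + ε)).tendsto 0).mono_left
        nhdsWithin_le_nhds
    · filter_upwards [Ioo_mem_nhdsGT hg0] with ε hε using key ε hε
  rw [div_lt_iff₀ hκ] at hcon
  nlinarith

end greenBound

/-! ### Explicit Riccati subsolutions -/

section subsolutions

variable {b k r y : ℝ}

/-- The Riccati bound is used on `[b, r]` with `ql` and on `[r, y]` with `-qr`. The zeros of the
weights at `b` and `y` remove the outer boundary terms, and the energy on `[y, b + 1]` is simply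
nonnegative. A free `y` allows weights that vanish before the right end. -/
theorem energy_ge (hb : 0 < b) (hr : r ∈ Icc b (b + 1)) (hy : y ∈ Icc r (b + 1))
    {ql ql' qr qr' : ℝ → ℝ} (hl : ContDiffOn ℝ 1 ql (Icc b r))
    (hl' : ∀ ρ ∈ Ioo b r, HasDerivAt ql (ql' ρ) ρ)
    (hlr : ∀ ρ ∈ Ioo b r, ql' ρ + ql ρ ^ 2 / ρ ≤ k ^ 2 * ρ) (hlb : ql b = 0)
    (hrc : ContDiffOn ℝ 1 qr (Icc r y)) (hr' : ∀ ρ ∈ Ioo r y, HasDerivAt qr (qr' ρ) ρ)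
    (hrr : ∀ ρ ∈ Ioo r y, -qr' ρ + qr ρ ^ 2 / ρ ≤ k ^ 2 * ρ) (hry : qr y = 0)
    {V z : ℝ → ℂ} (hz : MemLp z 2 (intervalMeasure b))
    (hV : ∀ ρ, V ρ = V b + ∫ t in b..ρ, z t) :
    (ql r + qr r) * ‖V r‖ ^ 2 ≤
      ∫ ρ in Ioo b (b + 1), (‖z ρ‖ ^ 2 + k ^ 2 * ‖V ρ‖ ^ 2) * ρ := by
  have hzi := integrable_of_memLp hz
  have hz2 : Integrable (fun ρ => ‖z ρ‖ ^ 2) (intervalMeasure b) :=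
    (memLp_two_iff_integrable_sq_norm hz.1).1 hz
  have hyI : y ∈ Icc b (b + 1) := ⟨hr.1.trans hy.1, hy.2⟩
  have hbI : b ∈ Icc b (b + 1) := by simp
  have hbI' : b + 1 ∈ Icc b (b + 1) := by simp
  have hVc : ContinuousOn V (Icc b (b + 1)) := by
    have h1 : ContinuousOn (fun ρ => ∫ t in b..ρ, z t) (Icc b (b + 1)) := by
      have := intervalIntegral.continuousOn_primitive_interval'
        (intervalIntegrable_of_integrable hzi) left_mem_uIcc
      rwa [uIcc_of_le (by linarith)] at this
    exact (continuousOn_const.add h1).congr fun ρ _ => hV ρ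
  have hV' {x : ℝ} (hx : x ∈ Icc b (b + 1)) :
      ∀ ρ ∈ Icc x (b + 1), V ρ = V x + ∫ t in x..ρ, z t := by
    intro ρ hρ
    rw [hV ρ, hV x, add_assoc, intervalIntegral.integral_add_adjacent_intervals
      (intervalIntegrable_of_mem_Icc hzi hbI hx)
      (intervalIntegrable_of_mem_Icc hzi hx ⟨hx.1.trans hρ.1, hρ.2⟩)]
  have hL := riccati_le hb hr.1 hl hl' hlr (V := V) (z := z)
    (intervalIntegrable_of_mem_Icc hzi hbI hr) (intervalIntegrable_of_mem_Icc hz2 hbI hr)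
    fun ρ _ => hV ρ
  have hR := riccati_le (k := k) (q := fun ρ => -qr ρ) (q' := fun ρ => -qr' ρ)
    (hb.trans_le hr.1) hy.1 hrc.neg
    (fun ρ hρ => (hr' ρ hρ).neg) (fun ρ hρ => by simpa using hrr ρ hρ) (V := V) (z := z)
    (intervalIntegrable_of_mem_Icc hzi hr hyI) (intervalIntegrable_of_mem_Icc hz2 hr hyI)
    fun ρ hρ => hV' hr ρ ⟨hρ.1, hρ.2.trans hy.2⟩
  have hi : Integrable (fun ρ => (‖z ρ‖ ^ 2 + k ^ 2 * ‖V ρ‖ ^ 2) * ρ) (intervalMeasure b) := by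
    refine IntegrableOn.mul_continuousOn_of_subset (A := Ioo b (b + 1)) (μ := volume)
      (K := Icc b (b + 1)) ?_ continuousOn_id
      measurableSet_Ioo isCompact_Icc Ioo_subset_Icc_self
    exact hz2.add ((continuousOn_const.mul (hVc.norm.pow 2)).integrableOn_Icc.mono_set
      Ioo_subset_Icc_self)
  have hrest : 0 ≤ ∫ ρ in y..(b + 1), (‖z ρ‖ ^ 2 + k ^ 2 * ‖V ρ‖ ^ 2) * ρ :=
    intervalIntegral.integral_nonneg hy.2 fun ρ hρ =>
      mul_nonneg (by positivity) (hb.le.trans (hyI.1.trans hρ.1))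
  rw [integral_Ioo_eq_interval, ← intervalIntegral.integral_add_adjacent_intervals
    (intervalIntegrable_of_mem_Icc hi hbI hr) (intervalIntegrable_of_mem_Icc hi hr hbI'),
    ← intervalIntegral.integral_add_adjacent_intervals
    (intervalIntegrable_of_mem_Icc hi hr hyI) (intervalIntegrable_of_mem_Icc hi hyI hbI')]
  rw [hlb] at hL
  simp only [hry] at hR
  linarith

theorem energy_ge_left (hb : 0 < b) (hr : r ∈ Icc b (b + 1)) {q q' : ℝ → ℝ}
    (hq : ContDiffOn ℝ 1 q (Icc b r)) (hq' : ∀ ρ ∈ Ioo b r, HasDerivAt q (q' ρ) ρ)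
    (h : ∀ ρ ∈ Ioo b r, q' ρ + q ρ ^ 2 / ρ ≤ k ^ 2 * ρ) (h0 : q b = 0)
    {V z : ℝ → ℂ} (hz : MemLp z 2 (intervalMeasure b))
    (hV : ∀ ρ, V ρ = V b + ∫ t in b..ρ, z t) :
    q r * ‖V r‖ ^ 2 ≤ ∫ ρ in Ioo b (b + 1), (‖z ρ‖ ^ 2 + k ^ 2 * ‖V ρ‖ ^ 2) * ρ := by
  have := energy_ge hb hr ⟨le_rfl, hr.2⟩ hq hq' h h0 (k := k) (qr := fun _ => 0)
    (qr' := fun _ => 0) contDiffOn_const (fun ρ _ => hasDerivAt_const ρ 0)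
    (fun ρ hρ => absurd (hρ.1.trans hρ.2) (lt_irrefl _)) rfl hz hV
  simpa using this

theorem energy_ge_right (hb : 0 < b) (hr : r ∈ Icc b (b + 1)) (hy : y ∈ Icc r (b + 1))
    {q q' : ℝ → ℝ}
    (hq : ContDiffOn ℝ 1 q (Icc r y)) (hq' : ∀ ρ ∈ Ioo r y, HasDerivAt q (q' ρ) ρ)
    (h : ∀ ρ ∈ Ioo r y, -q' ρ + q ρ ^ 2 / ρ ≤ k ^ 2 * ρ) (h0 : q y = 0)
    {V z : ℝ → ℂ} (hz : MemLp z 2 (intervalMeasure b))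
    (hV : ∀ ρ, V ρ = V b + ∫ t in b..ρ, z t) :
    q r * ‖V r‖ ^ 2 ≤ ∫ ρ in Ioo b (b + 1), (‖z ρ‖ ^ 2 + k ^ 2 * ‖V ρ‖ ^ 2) * ρ := by
  have := energy_ge hb hr hy (k := k) (ql := fun _ => 0)
    (ql' := fun _ => 0) contDiffOn_const (fun ρ _ => hasDerivAt_const ρ 0)
    (fun ρ hρ => by
      have : 0 < ρ := hb.trans hρ.1
      simp only [zero_add, ne_eq, OfNat.ofNat_ne_zero, not_false_eq_true, zero_pow, zero_div]
      positivity) rfl hq hq' h h0 hz hV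
  simpa using this

/-- A bound on the diagonal that is uniform in the interval. -/
theorem IsGreenFunction.diagonal_le_uniform (hb : 0 < b) {G : ℝ → ℝ → ℝ}
    (hG : IsGreenFunction b k G) {ε : ℝ} (hε : 0 < ε) (hk : 2 * ε + ε ^ 2 ≤ k ^ 2)
    (hr : r ∈ Icc b (b + 1)) : G r r ≤ 2 / ε := by
  have hr0 : 0 < r := hb.trans_le hr.1
  have he : r / (ε / 2 * r) = 2 / ε := by field_simp
  rw [← he]
  refine hG.diagonal_le hb hr (by positivity) fun V z hz hV => ?_
  -- The point `r` is at distance at least `1/2` from one endpoint; the weight `ε ρ` times the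
  -- distance to that endpoint is then at least `ε r / 2` at `r`.
  rcases le_total (b + 1 / 2) r with h | h
  · refine le_trans ?_ (energy_ge_left (k := k) (q := fun ρ => ε * ρ * (ρ - b))
      (q' := fun ρ => ε * (ρ - b) + ε * ρ) hb hr (by fun_prop) (fun ρ _ => ?_)
      (fun ρ hρ => ?_) (by simp) hz hV)
    · refine mul_le_mul_of_nonneg_right ?_ (sq_nonneg _)
      nlinarith [mul_le_mul_of_nonneg_left h (mul_pos hε hr0).le]
    · have := ((hasDerivAt_id ρ).const_mul ε).fun_mul ((hasDerivAt_id ρ).sub_const b)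
      simpa using this
    · have hρ0 : 0 < ρ := hb.trans hρ.1
      have e : (ε * ρ * (ρ - b)) ^ 2 / ρ = ε ^ 2 * (ρ - b) ^ 2 * ρ := by field_simp
      have h1 : (ρ - b) ^ 2 ≤ 1 := by
        rw [sq_le_one_iff₀ (by linarith [hρ.1])]
        linarith [hρ.2, hr.2]
      have h2 : ε ^ 2 * (ρ - b) ^ 2 * ρ ≤ ε ^ 2 * ρ := by
        gcongr
        exact mul_le_of_le_one_right (sq_nonneg _) h1
      have h3 : ε * (ρ - b) ≤ ε * ρ := by gcongr; linarith
      have h4 := mul_le_mul_of_nonneg_right hk hρ0.le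
      simp only [e]
      linarith
  · refine le_trans ?_ (energy_ge_right (k := k) (q := fun ρ => ε * ρ * (b + 1 - ρ))
      (q' := fun ρ => ε * (b + 1 - ρ) - ε * ρ) hb hr (y := b + 1) ⟨hr.2, le_rfl⟩
      (by fun_prop) (fun ρ _ => ?_) (fun ρ hρ => ?_) (by simp) hz hV)
    · refine mul_le_mul_of_nonneg_right ?_ (sq_nonneg _)
      nlinarith [mul_le_mul_of_nonneg_left h (mul_pos hε hr0).le]
    · have := ((hasDerivAt_id ρ).const_mul ε).fun_mul ((hasDerivAt_id ρ).const_sub (b + 1))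
      simpa [sub_eq_add_neg] using this
    · have hρ0 : 0 < ρ := hr0.trans hρ.1
      have e : (ε * ρ * (b + 1 - ρ)) ^ 2 / ρ = ε ^ 2 * (b + 1 - ρ) ^ 2 * ρ := by field_simp
      have h1 : (b + 1 - ρ) ^ 2 ≤ 1 := by
        rw [sq_le_one_iff₀ (by linarith [hρ.2])]
        linarith [hρ.1, hr.1]
      have h2 : ε ^ 2 * (b + 1 - ρ) ^ 2 * ρ ≤ ε ^ 2 * ρ := by
        gcongr
        exact mul_le_of_le_one_right (sq_nonneg _) h1
      have h3 : 0 ≤ ε * (b + 1 - ρ) := mul_nonneg hε.le (by linarith [hρ.2])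
      have h4 := mul_le_mul_of_nonneg_right hk hρ0.le
      have h5 : 0 < ε * ρ := by positivity
      simp only [e]
      linarith

/-- The Riccati inequality for the weight `c ρ^β (1 - ρ)` on `(0, 1)`. -/
theorem riccati_rpow {β c ρ : ℝ} (hβ : 0 < β) (hβ1 : β ≤ 1) (hc : 0 < c) (hc1 : c ≤ β / 2)
    (hc2 : 12 * c ≤ k ^ 2 * β) (h0 : 0 < ρ) (h1 : ρ < 1) :
    -(c * (β * ρ ^ (β - 1)) * (1 - ρ) - c * ρ ^ β) + (c * ρ ^ β * (1 - ρ)) ^ 2 / ρ ≤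
      k ^ 2 * ρ := by
  set s := ρ ^ (β - 1) with hs
  have hs0 : 0 < s := Real.rpow_pos_of_pos h0 _
  have hρβ : ρ ^ β = s * ρ := by
    rw [hs, ← Real.rpow_add_one h0.ne']; ring_nf
  have hsρ : s * ρ ≤ 1 := by
    rw [← hρβ]
    exact Real.rpow_le_one h0.le h1.le hβ.le
  have e : (c * (s * ρ) * (1 - ρ)) ^ 2 / ρ = c ^ 2 * s * (s * ρ) * (1 - ρ) ^ 2 := by
    field_simp
  have hL : (1 - ρ) ^ 2 ≤ 1 := by nlinarith
  have h2 : c ^ 2 * s * (s * ρ) * (1 - ρ) ^ 2 ≤ c ^ 2 * s := by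
    calc c ^ 2 * s * (s * ρ) * (1 - ρ) ^ 2 ≤ c ^ 2 * s * 1 * 1 := by gcongr
      _ = c ^ 2 * s := by ring
  rw [hρβ, e]
  -- For `ρ ≤ β/4` the derivative of `ρ^β` dominates and the left side is nonpositive, as `c ≤ β/2`.
  -- For `ρ ≥ β/4` the left side is at most `c + 2c = 3c`, while `k²ρ ≥ k²β/4 ≥ 3c`.
  rcases le_total ρ (β / 4) with h | h
  · have h3 : c * s * (c + ρ - β * (1 - ρ)) ≤ 0 := by
      refine mul_nonpos_of_nonneg_of_nonpos (by positivity) ?_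
      nlinarith
    have h4 : 0 ≤ k ^ 2 * ρ := by positivity
    nlinarith
  · have h3 : 0 ≤ c * (β * s) * (1 - ρ) := mul_nonneg (by positivity) (by linarith)
    have h4 : c * (s * ρ) ≤ c := mul_le_of_le_one_right hc.le hsρ
    have h5 : s * β ≤ 4 := by nlinarith
    have h6 : c ^ 2 * s ≤ 2 * c := by
      have : c * s ≤ 2 := by nlinarith
      nlinarith
    have h7 : k ^ 2 * (β / 4) ≤ k ^ 2 * ρ := by gcongr
    linarith

theorem IsGreenFunction.diagonal_le_rpow (hb : 0 < b) {G : ℝ → ℝ → ℝ}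
    (hG : IsGreenFunction b k G) {α c : ℝ} (hα : 0 ≤ α) (hc : 0 < c)
    (hc1 : c ≤ (1 - α) / 2) (hc2 : 12 * c ≤ k ^ 2 * (1 - α)) (hr : r ∈ Icc b (b + 1))
    (hr1 : r ≤ 1 / 2) : G r r ≤ 2 / c * r ^ α := by
  have hr0 : 0 < r := hb.trans_le hr.1
  have hrα : r ^ (1 - α) * r ^ α = r := by
    rw [← Real.rpow_add hr0]; simp
  have hp : 0 < r ^ (1 - α) := Real.rpow_pos_of_pos hr0 _
  have he : r / (c * r ^ (1 - α) / 2) = 2 / c * r ^ α := by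
    rw [div_eq_iff (by positivity)]
    field_simp
    rw [mul_comm, hrα]
  rw [← he]
  refine hG.diagonal_le hb hr (by positivity) fun V z hz hV => ?_
  -- The weight vanishes at `y = 1`, which lies in `[r, b + 1]` for every `b > 0`, so the bound does
  -- not depend on `b`; `r ≤ 1/2` gives `1 - r ≥ 1/2`.
  refine le_trans ?_ (energy_ge_right (k := k) (q := fun ρ => c * ρ ^ (1 - α) * (1 - ρ))
    (q' := fun ρ => c * ((1 - α) * ρ ^ (1 - α - 1)) * (1 - ρ) - c * ρ ^ (1 - α)) hb hr
    (y := 1) ⟨by linarith, by linarith⟩ ?_ (fun ρ hρ => ?_) (fun ρ hρ => ?_) (by simp) hz hV)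
  · gcongr
    nlinarith [mul_pos hc hp]
  · have h1 : ContDiffOn ℝ 1 (fun ρ : ℝ => ρ ^ (1 - α)) (Icc r 1) :=
      contDiffOn_id.rpow_const_of_ne fun ρ hρ => (hr0.trans_le hρ.1).ne'
    exact (contDiffOn_const.mul h1).mul (by fun_prop)
  · have h1 := (Real.hasDerivAt_rpow_const (p := 1 - α)
      (Or.inl (hr0.trans hρ.1).ne')).const_mul c
    have := h1.fun_mul ((hasDerivAt_id ρ).const_sub 1)
    simpa [sub_eq_add_neg] using this
  · exact riccati_rpow (by linarith) (by linarith) hc hc1 hc2 (hr0.trans hρ.1) hρ.2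

end subsolutions

/-! ### The constant `1/3` at `k = 3.555` -/

section polynomial

open Polynomial

variable {b k r : ℝ}

theorem contDiff_eval (p : ℝ[X]) : ContDiff ℝ 1 fun t => p.eval t := by
  simpa using p.contDiff_aeval (𝕜 := ℝ) 1

/-- Sub- and supersolutions built from polynomials bound the diagonal of the Green function. -/
theorem IsGreenFunction.diagonal_le_polynomial (hb : 0 < b) {G : ℝ → ℝ → ℝ}
    (hG : IsGreenFunction b k G) {p q : ℝ[X]} {m : ℝ} (hm : 0 < m)
    (hp : ∀ t ∈ Icc (0 : ℝ) 1, 0 < p.eval t) (hq : ∀ t ∈ Icc (0 : ℝ) 1, 0 < q.eval t)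
    (hp1 : ∀ t ∈ Icc (0 : ℝ) 1, 0 ≤ (derivative p).eval t)
    (hq1 : ∀ t ∈ Icc (0 : ℝ) 1, 0 ≤ (derivative q).eval t)
    (hp2 : ∀ t ∈ Icc (0 : ℝ) 1, t * (derivative (derivative p)).eval t +
      (derivative p).eval t ≤ k ^ 2 * (t * p.eval t))
    (hq2 : ∀ t ∈ Icc (0 : ℝ) 1, (derivative (derivative q)).eval t ≤ k ^ 2 * q.eval t)
    (hp0 : (derivative p).eval 0 = 0) (hq0 : (derivative q).eval 0 = 0)
    (hpq : ∀ t ∈ Icc (0 : ℝ) 1, m * (p.eval t * q.eval (1 - t)) ≤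
      (derivative p).eval t * q.eval (1 - t) + (derivative q).eval (1 - t) * p.eval t)
    (hr : r ∈ Icc b (b + 1)) : G r r ≤ 1 / m := by
  have hr0 : 0 < r := hb.trans_le hr.1
  have he : r / (m * r) = 1 / m := by field_simp
  rw [← he]
  refine hG.diagonal_le hb hr (by positivity) fun V z hz hV => ?_
  have hlt {ρ : ℝ} (hρ : ρ ∈ Icc b (b + 1)) : ρ - b ∈ Icc (0 : ℝ) 1 :=
    ⟨by linarith [hρ.1], by linarith [hρ.2]⟩
  have hrt {ρ : ℝ} (hρ : ρ ∈ Icc b (b + 1)) : b + 1 - ρ ∈ Icc (0 : ℝ) 1 :=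
    ⟨by linarith [hρ.2], by linarith [hρ.1]⟩
  -- Weights of the form `ρ` times a logarithmic derivative linearise the Riccati inequality to `(ρ
  -- p')' ≤ k² ρ p`, with the prime denoting differentiation in `ρ`.
  refine le_trans ?_ (energy_ge (k := k) hb hr (y := b + 1) ⟨hr.2, le_rfl⟩
    (ql := fun ρ => ρ * ((derivative p).eval (ρ - b) / p.eval (ρ - b)))
    (ql' := fun ρ => (derivative p).eval (ρ - b) / p.eval (ρ - b) + ρ *
      (((derivative (derivative p)).eval (ρ - b) * p.eval (ρ - b) -
        (derivative p).eval (ρ - b) * (derivative p).eval (ρ - b)) / p.eval (ρ - b) ^ 2))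
    (qr := fun ρ => ρ * ((derivative q).eval (b + 1 - ρ) / q.eval (b + 1 - ρ)))
    (qr' := fun ρ => (derivative q).eval (b + 1 - ρ) / q.eval (b + 1 - ρ) + ρ *
      ((-(derivative (derivative q)).eval (b + 1 - ρ) * q.eval (b + 1 - ρ) -
        (derivative q).eval (b + 1 - ρ) * -(derivative q).eval (b + 1 - ρ)) /
          q.eval (b + 1 - ρ) ^ 2))
    ?_ (fun ρ hρ => ?_) (fun ρ hρ => ?_) (by simp [hp0])
    ?_ (fun ρ hρ => ?_) (fun ρ hρ => ?_) (by simp [hq0]) hz hV)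
  · gcongr
    have h1 := hp _ (hlt hr)
    have h2 := hq _ (hrt hr)
    have h3 := hpq _ (hlt hr)
    rw [show 1 - (r - b) = b + 1 - r by ring] at h3
    rw [← mul_add, mul_comm m, div_add_div _ _ h1.ne' h2.ne']
    gcongr
    rw [le_div_iff₀ (by positivity)]
    linarith
  · refine contDiffOn_id.mul (ContDiffOn.div ?_ ?_ fun ρ hρ =>
      (hp _ (hlt ⟨hρ.1, hρ.2.trans hr.2⟩)).ne')
    · exact ((contDiff_eval _).comp (contDiff_id.sub contDiff_const)).contDiffOn
    · exact ((contDiff_eval _).comp (contDiff_id.sub contDiff_const)).contDiffOn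
  · have hρI : ρ ∈ Icc b (b + 1) := ⟨hρ.1.le, hρ.2.le.trans hr.2⟩
    have h1 := ((derivative p).hasDerivAt (ρ - b)).comp_sub_const ρ b
    have h2 := (p.hasDerivAt (ρ - b)).comp_sub_const ρ b
    simpa using (hasDerivAt_id ρ).fun_mul (h1.fun_div h2 (hp _ (hlt hρI)).ne')
  · have hρI : ρ ∈ Icc b (b + 1) := ⟨hρ.1.le, hρ.2.le.trans hr.2⟩
    have hρ0 : 0 < ρ := hb.trans hρ.1
    have ht : 0 < ρ - b := by linarith [hρ.1]
    have h1 := hp _ (hlt hρI)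
    have h2 := hp2 _ (hlt hρI)
    have h3 := hp1 _ (hlt hρI)
    set t := ρ - b
    set P := p.eval t
    set P1 := (derivative p).eval t
    set P2 := (derivative (derivative p)).eval t
    have e : P1 / P + ρ * ((P2 * P - P1 * P1) / P ^ 2) + (ρ * (P1 / P)) ^ 2 / ρ =
        (P1 + ρ * P2) / P := by
      field_simp
      ring
    rw [e, div_le_iff₀ h1]
    -- The hypothesis on `p` is the case `b = 0`, where `t = ρ`. It carries over to `b > 0` because
    -- the surplus `(t - ρ) P1` is nonpositive.
    have h4 : t * (P1 + ρ * P2) ≤ t * (k ^ 2 * ρ * P) := by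
      have h5 : t ≤ ρ := by simp only [t]; linarith
      nlinarith [mul_le_mul_of_nonneg_left h2 hρ0.le, mul_le_mul_of_nonneg_right h5 h3]
    exact le_of_mul_le_mul_left h4 ht
  · refine contDiffOn_id.mul (ContDiffOn.div ?_ ?_ fun ρ hρ =>
      (hq _ (hrt ⟨hr.1.trans hρ.1, hρ.2⟩)).ne')
    · exact ((contDiff_eval _).comp (contDiff_const.sub contDiff_id)).contDiffOn
    · exact ((contDiff_eval _).comp (contDiff_const.sub contDiff_id)).contDiffOn
  · have hρI : ρ ∈ Icc b (b + 1) := ⟨hr.1.trans hρ.1.le, hρ.2.le⟩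
    have h1 := ((derivative q).hasDerivAt (b + 1 - ρ)).comp_const_sub (b + 1) ρ
    have h2 := (q.hasDerivAt (b + 1 - ρ)).comp_const_sub (b + 1) ρ
    simpa using (hasDerivAt_id ρ).fun_mul (h1.fun_div h2 (hq _ (hrt hρI)).ne')
  · have hρI : ρ ∈ Icc b (b + 1) := ⟨hr.1.trans hρ.1.le, hρ.2.le⟩
    have hρ0 : 0 < ρ := hr0.trans hρ.1
    have h1 := hq _ (hrt hρI)
    have h2 := hq2 _ (hrt hρI)
    have h3 := hq1 _ (hrt hρI)
    set t := b + 1 - ρ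
    set Q := q.eval t
    set Q1 := (derivative q).eval t
    set Q2 := (derivative (derivative q)).eval t
    have e : -(Q1 / Q + ρ * ((-Q2 * Q - Q1 * -Q1) / Q ^ 2)) + (ρ * (Q1 / Q)) ^ 2 / ρ =
        (-Q1 + ρ * Q2) / Q := by
      field_simp
      ring
    rw [e, div_le_iff₀ h1]
    nlinarith [mul_le_mul_of_nonneg_left h2 hρ0.le]

/-- A polynomial below the modified Bessel function `I₀(3.555 t)`. -/
def besselPoly : ℝ[X] :=
  1 + C (6319 / 2000) * X ^ 2 + C (249561 / 100000) * X ^ 4 + C (87609 / 100000) * X ^ 6 +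
    C (173 / 1000) * X ^ 8 + C (1093 / 50000) * X ^ 10 + C (191 / 100000) * X ^ 12 +
    C (3 / 25000) * X ^ 14

/-- A polynomial below `cosh (3.555 t)`. -/
def coshPoly : ℝ[X] :=
  1 + C (63 / 10) * X ^ 2 + C (33 / 5) * X ^ 4 + C (27 / 10) * X ^ 6

theorem eval_besselPoly (t : ℝ) : besselPoly.eval t =
    1 + 6319 / 2000 * t ^ 2 + 249561 / 100000 * t ^ 4 + 87609 / 100000 * t ^ 6 +
    173 / 1000 * t ^ 8 + 1093 / 50000 * t ^ 10 + 191 / 100000 * t ^ 12 +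
    3 / 25000 * t ^ 14 := by
  simp [besselPoly]

theorem eval_derivative_besselPoly (t : ℝ) : (derivative besselPoly).eval t =
    6319 / 1000 * t + 249561 / 25000 * t ^ 3 + 262827 / 50000 * t ^ 5 +
    173 / 125 * t ^ 7 + 1093 / 5000 * t ^ 9 + 573 / 25000 * t ^ 11 +
    21 / 12500 * t ^ 13 := by
  simp [besselPoly]
  ring

theorem eval_derivative_derivative_besselPoly (t : ℝ) :
    (derivative (derivative besselPoly)).eval t =
    6319 / 1000 + 748683 / 25000 * t ^ 2 + 262827 / 10000 * t ^ 4 +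
    1211 / 125 * t ^ 6 + 9837 / 5000 * t ^ 8 + 6303 / 25000 * t ^ 10 +
    273 / 12500 * t ^ 12 := by
  simp [besselPoly]
  ring

theorem eval_coshPoly (t : ℝ) :
    coshPoly.eval t = 1 + 63 / 10 * t ^ 2 + 33 / 5 * t ^ 4 + 27 / 10 * t ^ 6 := by
  simp [coshPoly]

theorem eval_derivative_coshPoly (t : ℝ) : (derivative coshPoly).eval t =
    63 / 5 * t + 132 / 5 * t ^ 3 + 81 / 5 * t ^ 5 := by
  simp [coshPoly]
  ring

theorem eval_derivative_derivative_coshPoly (t : ℝ) :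
    (derivative (derivative coshPoly)).eval t = 63 / 5 + 396 / 5 * t ^ 2 + 81 * t ^ 4 := by
  simp [coshPoly]
  ring

/-- The logarithmic derivatives of `besselPoly` at `t` and of `coshPoly` at `1 - t` add up to at
least `3`; the difference has positive coefficients in the Bernstein basis. -/
theorem besselPoly_coshPoly_ge {t : ℝ} (ht : t ∈ Icc (0 : ℝ) 1) :
    3 * (besselPoly.eval t * coshPoly.eval (1 - t)) ≤
      (derivative besselPoly).eval t * coshPoly.eval (1 - t) +
        (derivative coshPoly).eval (1 - t) * besselPoly.eval t := by
  have h0 : 0 ≤ t := ht.1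
  have h1 : 0 ≤ 1 - t := by linarith [ht.2]
  rw [eval_besselPoly, eval_derivative_besselPoly, eval_coshPoly, eval_derivative_coshPoly,
    ← sub_nonneg]
  -- Homogenising with `t + (1 - t) = 1` to degree `14 + 6 = 20`. The last coefficient is the
  -- difference at `t = 1`, namely `p'(1) - 3 p(1)` for `p` the Bessel polynomial: it is nearly
  -- zero, so `I₀` needs many accurate terms, whereas a crude minorant of `cosh` is enough.
  have h : 0 ≤
      27/5 * t ^ 0 * (1 - t) ^ 20 +
      1028477/5000 * t ^ 1 * (1 - t) ^ 19 +
      25324651/10000 * t ^ 2 * (1 - t) ^ 18 +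
      2163522513/125000 * t ^ 3 * (1 - t) ^ 17 +
      39382485537/500000 * t ^ 4 * (1 - t) ^ 16 +
      8146669179/31250 * t ^ 5 * (1 - t) ^ 15 +
      20622254001/31250 * t ^ 6 * (1 - t) ^ 14 +
      82369380673/62500 * t ^ 7 * (1 - t) ^ 13 +
      2117909952187/1000000 * t ^ 8 * (1 - t) ^ 12 +
      1386300563347/500000 * t ^ 9 * (1 - t) ^ 11 +
      14884379783/5000 * t ^ 10 * (1 - t) ^ 10 +
      328371382411/125000 * t ^ 11 * (1 - t) ^ 9 +
      950505023289/500000 * t ^ 12 * (1 - t) ^ 8 +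
      35004387483/31250 * t ^ 13 * (1 - t) ^ 7 +
      53045713737/100000 * t ^ 14 * (1 - t) ^ 6 +
      12350785581/62500 * t ^ 15 * (1 - t) ^ 5 +
      27969350723/500000 * t ^ 16 * (1 - t) ^ 4 +
      5672746391/500000 * t ^ 17 * (1 - t) ^ 3 +
      1473736541/1000000 * t ^ 18 * (1 - t) ^ 2 +
      46234647/500000 * t ^ 19 * (1 - t) ^ 1 +
      91/100000 * t ^ 20 * (1 - t) ^ 0 := by positivity
  refine h.trans_eq ?_
  ring

theorem IsGreenFunction.diagonal_le_third (hb : 0 < b) {G : ℝ → ℝ → ℝ}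
    (hG : IsGreenFunction b 3.555 G) (hr : r ∈ Icc b (b + 1)) : G r r ≤ 1 / 3 := by
  refine hG.diagonal_le_polynomial hb (p := besselPoly) (q := coshPoly) (by norm_num)
    (fun t ht => ?_) (fun t ht => ?_) (fun t ht => ?_) (fun t ht => ?_) (fun t ht => ?_)
    (fun t ht => ?_) (by simp [eval_derivative_besselPoly]) (by simp [eval_derivative_coshPoly])
    (fun t ht => besselPoly_coshPoly_ge ht) hr
  · rw [eval_besselPoly]; positivity
  · rw [eval_coshPoly]; positivity
  · have h0 : 0 ≤ t := ht.1
    rw [eval_derivative_besselPoly]; positivity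
  · have h0 : 0 ≤ t := ht.1
    rw [eval_derivative_coshPoly]; positivity
  · have h0 : 0 ≤ t := ht.1
    rw [eval_derivative_derivative_besselPoly, eval_derivative_besselPoly, eval_besselPoly]
    have h1 : 0 ≤ t ^ 3 := by positivity
    have h2 : 0 ≤ t ^ 5 := by positivity
    have h3 : 0 ≤ t ^ 7 := by positivity
    have h4 : 0 ≤ t ^ 9 := by positivity
    have h5 : 0 ≤ t ^ 11 := by positivity
    have h6 : 0 ≤ t ^ 13 := by positivity
    have h7 : 0 ≤ t ^ 15 := by positivity
    -- The inequality holds coefficient by coefficient, since each polynomial coefficient is at most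
    -- what the power series recursion allows from the preceding one.
    ring_nf
    linarith
  · rw [eval_derivative_derivative_coshPoly, eval_coshPoly]
    have h1 : 0 ≤ t ^ 2 := by positivity
    have h2 : 0 ≤ t ^ 4 := by positivity
    have h3 : 0 ≤ t ^ 6 := by positivity
    ring_nf
    linarith

end polynomial

/-! ### The form domain as a closed subspace, and the resolvent as a projection -/

/-- The Hilbert space in which `u ↦ (k u, √r (u / √r)')` embeds the form domain isometrically. -/
abbrev EnergySpace (b : ℝ) : Type := WithLp 2 (L2 b × L2 b)

section toL2

variable {b : ℝ}

open Classical in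
/-- The class of a square integrable function in `L²(b, b + 1)`. -/
def toL2 (b : ℝ) (g : ℝ → ℂ) : L2 b :=
  if h : MemLp g 2 (intervalMeasure b) then h.toLp g else 0

theorem coeFn_toL2 {g : ℝ → ℂ} (h : MemLp g 2 (intervalMeasure b)) :
    toL2 b g =ᵐ[intervalMeasure b] g := by
  rw [toL2, dif_pos h]
  exact h.coeFn_toLp

theorem memLp_ofReal {a : ℝ → ℝ} (ha : ContinuousOn a (Icc b (b + 1))) :
    MemLp (fun s => (a s : ℂ)) 2 (intervalMeasure b) :=
  memLp_of_continuousOn (Complex.continuous_ofReal.comp_continuousOn ha)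

theorem inner_toL2_ofReal {a : ℝ → ℝ} (ha : MemLp (fun s => (a s : ℂ)) 2 (intervalMeasure b))
    (f : L2 b) : inner ℂ (toL2 b fun s => (a s : ℂ)) f = ∫ s in Ioo b (b + 1), a s • f s := by
  rw [L2.inner_def]
  refine integral_congr_ae ?_
  filter_upwards [coeFn_toL2 ha] with s hs
  rw [hs, RCLike.inner_apply, Complex.conj_ofReal, Complex.real_smul, mul_comm]

theorem star_toL2_ofReal {a : ℝ → ℝ} (ha : MemLp (fun s => (a s : ℂ)) 2 (intervalMeasure b)) :
    star (toL2 b fun s => (a s : ℂ)) = toL2 b fun s => (a s : ℂ) := by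
  refine Lp.ext ?_
  filter_upwards [Lp.coeFn_star (toL2 b fun s => (a s : ℂ)), coeFn_toL2 ha] with s h1 h2
  rw [h1, Pi.star_apply, h2, RCLike.star_def, Complex.conj_ofReal]

end toL2

section energySpace

variable {b k : ℝ}

/-- The pair of classes of two real-valued functions. -/
def realVector (b : ℝ) (a c : ℝ → ℝ) : EnergySpace b :=
  WithLp.toLp 2 (toL2 b fun s => (a s : ℂ), toL2 b fun s => (c s : ℂ))

theorem inner_realVector {a c : ℝ → ℝ} (ha : MemLp (fun s => (a s : ℂ)) 2 (intervalMeasure b))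
    (hc : MemLp (fun s => (c s : ℂ)) 2 (intervalMeasure b)) (x : EnergySpace b) :
    inner ℂ (realVector b a c) x =
      (∫ s in Ioo b (b + 1), a s • x.fst s) + ∫ s in Ioo b (b + 1), c s • x.snd s := by
  rw [WithLp.prod_inner_apply, realVector]
  exact congrArg₂ _ (inner_toL2_ofReal ha _) (inner_toL2_ofReal hc _)

/-- The vector whose inner product with `(k u, √r z)` tests whether `z` is a weak derivative of
`u / √r`. -/
def testVector (b k : ℝ) (φ : ℝ → ℝ) : EnergySpace b :=
  realVector b (fun s => deriv φ s * (Real.sqrt s)⁻¹) (fun s => φ s * (k * (Real.sqrt s)⁻¹))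

/-- The range of `u ↦ (k u, √r (u / √r)')` on the form domain. -/
def formSubspace (b k : ℝ) : Submodule ℂ (EnergySpace b) :=
  (Submodule.span ℂ {x | ∃ φ, IsTestFunction b φ ∧ x = testVector b k φ})ᗮ

theorem mem_formSubspace_iff_inner {x : EnergySpace b} :
    x ∈ formSubspace b k ↔ ∀ φ, IsTestFunction b φ → inner ℂ (testVector b k φ) x = 0 := by
  rw [formSubspace, Submodule.mem_orthogonal]
  constructor
  · exact fun h φ hφ => h _ (Submodule.subset_span ⟨φ, hφ, rfl⟩)
  · intro h y hy
    induction hy using Submodule.span_induction with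
    | mem y hy =>
      obtain ⟨φ, hφ, rfl⟩ := hy
      exact h φ hφ
    | zero => exact inner_zero_left _
    | add y y' _ _ h1 h2 => rw [inner_add_left, h1, h2, add_zero]
    | smul c y _ h1 => rw [inner_smul_left, h1, mul_zero]

theorem memLp_testVector (hb : 0 < b) {φ : ℝ → ℝ} (hφ : IsTestFunction b φ) :
    MemLp (fun s => ((deriv φ s * (Real.sqrt s)⁻¹ : ℝ) : ℂ)) 2 (intervalMeasure b) ∧
      MemLp (fun s => ((φ s * (k * (Real.sqrt s)⁻¹) : ℝ) : ℂ)) 2 (intervalMeasure b) :=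
  ⟨memLp_ofReal (hφ.derivative.continuous.continuousOn.mul (continuousOn_inv_sqrt hb)),
    memLp_ofReal (hφ.continuous.continuousOn.mul
      (continuousOn_const.mul (continuousOn_inv_sqrt hb)))⟩

/-- Orthogonality to the test vectors is the weak derivative identity itself. As an orthogonal
complement the subspace is closed, which expresses the closedness of the form. -/
theorem mem_formSubspace_iff (hb : 0 < b) {x : EnergySpace b} :
    x ∈ formSubspace b k ↔ HasWeakDeriv b (fun r => (Real.sqrt r)⁻¹ • x.fst r)
      (fun r => (k * (Real.sqrt r)⁻¹) • x.snd r) := by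
  rw [mem_formSubspace_iff_inner, hasWeakDeriv_iff]
  refine forall₂_congr fun φ hφ => ?_
  rw [testVector, inner_realVector (memLp_testVector (k := k) hb hφ).1 (memLp_testVector hb hφ).2,
    ← eq_neg_iff_add_eq_zero]
  simp only [mul_smul]

/-- Complex conjugation of both components. -/
def conjVector (x : EnergySpace b) : EnergySpace b :=
  WithLp.toLp 2 (star x.fst, star x.snd)

theorem inner_star_L2 (f g : L2 b) :
    inner ℂ (star f) g = starRingEnd ℂ (inner ℂ f (star g)) := by
  rw [L2.inner_def, L2.inner_def, ← integral_conj]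
  refine integral_congr_ae ?_
  filter_upwards [Lp.coeFn_star f, Lp.coeFn_star g] with s h1 h2
  rw [h1, h2]
  simp [RCLike.inner_apply]

theorem inner_conjVector (x y : EnergySpace b) :
    inner ℂ (conjVector x) y = starRingEnd ℂ (inner ℂ x (conjVector y)) := by
  rw [WithLp.prod_inner_apply, WithLp.prod_inner_apply, map_add]
  exact congrArg₂ _ (inner_star_L2 _ _) (inner_star_L2 _ _)

theorem conjVector_conjVector (x : EnergySpace b) : conjVector (conjVector x) = x := by
  have h : conjVector (conjVector x) = WithLp.toLp 2 (star (star x.fst), star (star x.snd)) := rfl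
  rw [h, star_star, star_star]
  rfl

theorem conjVector_realVector {a c : ℝ → ℝ}
    (ha : MemLp (fun s => (a s : ℂ)) 2 (intervalMeasure b))
    (hc : MemLp (fun s => (c s : ℂ)) 2 (intervalMeasure b)) :
    conjVector (realVector b a c) = realVector b a c := by
  have h : conjVector (realVector b a c) = WithLp.toLp 2
    (star (toL2 b fun s => (a s : ℂ)), star (toL2 b fun s => (c s : ℂ))) := rfl
  rw [h, star_toL2_ofReal ha, star_toL2_ofReal hc, realVector]

theorem conjVector_mem_formSubspace (hb : 0 < b) {x : EnergySpace b}
    (hx : x ∈ formSubspace b k) : conjVector x ∈ formSubspace b k := by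
  rw [mem_formSubspace_iff_inner] at *
  intro φ hφ
  have h := memLp_testVector (k := k) hb hφ
  have e : testVector b k φ = conjVector (testVector b k φ) :=
    (conjVector_realVector h.1 h.2).symm
  rw [e, inner_conjVector, conjVector_conjVector, hx φ hφ, map_zero]

instance : (formSubspace b k).HasOrthogonalProjection := by
  have : CompleteSpace (formSubspace b k) :=
    (Submodule.isClosed_orthogonal _).completeSpace_coe
  exact Submodule.HasOrthogonalProjection.ofCompleteSpace _

/-- The orthogonal projection onto the form domain. -/
def formProjection (b k : ℝ) : EnergySpace b →L[ℂ] EnergySpace b :=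
  (formSubspace b k).starProjection

theorem formProjection_mem (x : EnergySpace b) : formProjection b k x ∈ formSubspace b k :=
  Submodule.starProjection_apply_mem _ _

theorem inner_formProjection_comm (x y : EnergySpace b) :
    inner ℂ (formProjection b k x) y = inner ℂ x (formProjection b k y) :=
  Submodule.inner_starProjection_left_eq_right _ _ _

theorem formProjection_eq_self {x : EnergySpace b} (hx : x ∈ formSubspace b k) :
    formProjection b k x = x :=
  Submodule.starProjection_eq_self_iff.2 hx

theorem inner_formProjection_of_mem {x : EnergySpace b} (hx : x ∈ formSubspace b k)
    (y : EnergySpace b) : inner ℂ x (formProjection b k y) = inner ℂ x y := by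
  rw [← inner_formProjection_comm, formProjection_eq_self hx]

/-- The subspace is invariant under conjugation, so the projection fixes the class of real vectors.
This makes the Green function real-valued. -/
theorem conjVector_formProjection (hb : 0 < b) {e : EnergySpace b} (he : conjVector e = e) :
    conjVector (formProjection b k e) = formProjection b k e := by
  refine (Submodule.eq_starProjection_of_mem_of_inner_eq_zero
    (conjVector_mem_formSubspace hb (formProjection_mem e)) fun w hw => ?_).symm
  rw [inner_sub_left, inner_conjVector, inner_formProjection_comm,
    formProjection_eq_self (conjVector_mem_formSubspace hb hw), ← inner_conjVector, he, sub_self]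

theorem inner_real_of_conjVector_eq {x y : EnergySpace b} (hx : conjVector x = x)
    (hy : conjVector y = y) : (((inner ℂ x y : ℂ).re : ℝ) : ℂ) = inner ℂ x y := by
  have h := inner_conjVector x y
  rw [hx, hy] at h
  exact Complex.conj_eq_iff_re.1 h.symm

end energySpace

section lift

variable {b k : ℝ}

/-- The embedding `u ↦ (k u, √r (u / √r)')` of the form domain. -/
def formLift (b k : ℝ) (u : L2 b) : EnergySpace b :=
  WithLp.toLp 2 (((k : ℝ) : ℂ) • u, toL2 b fun r => Real.sqrt r • groundStateDeriv b u r)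

theorem memLp_sqrt_smul {z : ℝ → ℂ} (hz : MemLp z 2 (intervalMeasure b)) :
    MemLp (fun r => Real.sqrt r • z r) 2 (intervalMeasure b) :=
  memLp_smul Real.continuous_sqrt.continuousOn hz

theorem formLift_mem (hb : 0 < b) {u : L2 b} (hu : MemH1 b u) :
    formLift b k u ∈ formSubspace b k := by
  obtain ⟨hz, h⟩ := groundStateDeriv_spec hb hu
  rw [mem_formSubspace_iff hb]
  rw [div_sqrt_eq_smul] at h
  refine (h.const_smul k).congr_ae ?_ ?_
  · filter_upwards [Lp.coeFn_smul ((k : ℝ) : ℂ) u] with r hr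
    change _ = (Real.sqrt r)⁻¹ • (((k : ℝ) : ℂ) • u) r
    rw [hr, Pi.smul_apply, smul_comm, Complex.coe_smul]
  · filter_upwards [coeFn_toL2 (memLp_sqrt_smul hz), ae_restrict_mem measurableSet_Ioo]
      with r hr hr'
    change _ = (k * (Real.sqrt r)⁻¹) • (toL2 b fun r => Real.sqrt r • groundStateDeriv b u r) r
    have : Real.sqrt r ≠ 0 := (Real.sqrt_pos.2 (hb.trans hr'.1)).ne'
    rw [hr, smul_smul, mul_assoc, inv_mul_cancel₀ this, mul_one]

/-- Surjectivity of the lift onto `formSubspace`: `x.snd / √r` is a square integrable weak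
derivative, and uniqueness identifies it with `groundStateDeriv`. -/
theorem formLift_of_mem (hb : 0 < b) (hk : 0 < k) {x : EnergySpace b}
    (hx : x ∈ formSubspace b k) : MemH1 b (((k⁻¹ : ℝ) : ℂ) • x.fst) ∧
      formLift b k (((k⁻¹ : ℝ) : ℂ) • x.fst) = x := by
  rw [mem_formSubspace_iff hb] at hx
  have hz : MemLp (fun r => (Real.sqrt r)⁻¹ • x.snd r) 2 (intervalMeasure b) :=
    memLp_smul (continuousOn_inv_sqrt hb) (Lp.memLp x.snd)
  have hd : HasWeakDeriv b (fun r => (((k⁻¹ : ℝ) : ℂ) • x.fst) r / (Real.sqrt r : ℂ))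
      (fun r => (Real.sqrt r)⁻¹ • x.snd r) := by
    rw [div_sqrt_eq_smul]
    refine (hx.const_smul k⁻¹).congr_ae ?_ ?_
    · filter_upwards [Lp.coeFn_smul ((k⁻¹ : ℝ) : ℂ) x.fst] with r hr
      rw [hr, Pi.smul_apply, smul_comm, Complex.coe_smul]
    · refine Filter.Eventually.of_forall fun r => ?_
      simp only [smul_smul, ← mul_assoc, inv_mul_cancel₀ hk.ne', one_mul]
  refine ⟨(memH1_iff hb _).2 ⟨_, hz, hd⟩, ?_⟩
  have e1 : ((k : ℝ) : ℂ) • (((k⁻¹ : ℝ) : ℂ) • x.fst) = x.fst := by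
    rw [smul_smul, ← Complex.ofReal_mul, mul_inv_cancel₀ hk.ne', Complex.ofReal_one, one_smul]
  have e2 : (toL2 b fun r => Real.sqrt r •
      groundStateDeriv b (((k⁻¹ : ℝ) : ℂ) • x.fst) r) = x.snd := by
    have hg := groundStateDeriv_ae_eq hb hz hd
    have hm := (groundStateDeriv_spec hb ((memH1_iff hb _).2 ⟨_, hz, hd⟩)).1
    refine Lp.ext ?_
    filter_upwards [coeFn_toL2 (memLp_sqrt_smul hm), hg, ae_restrict_mem measurableSet_Ioo]
      with r h1 h2 hr'
    have : Real.sqrt r ≠ 0 := (Real.sqrt_pos.2 (hb.trans hr'.1)).ne'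
    rw [h1, h2, smul_smul, mul_inv_cancel₀ this, one_smul]
  rw [formLift, e1, e2]
  rfl

theorem inner_formLift (hb : 0 < b) {u v : L2 b} (hu : MemH1 b u) (hv : MemH1 b v) :
    inner ℂ (formLift b k v) (formLift b k u) =
      ((k ^ 2 : ℝ) : ℂ) * inner ℂ v u + form b v u := by
  have e : inner ℂ (toL2 b fun r => Real.sqrt r • groundStateDeriv b v r)
      (toL2 b fun r => Real.sqrt r • groundStateDeriv b u r) = form b v u := by
    rw [L2.inner_def, form]
    refine integral_congr_ae ?_
    filter_upwards [coeFn_toL2 (memLp_sqrt_smul (groundStateDeriv_spec hb hu).1),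
      coeFn_toL2 (memLp_sqrt_smul (groundStateDeriv_spec hb hv).1),
      ae_restrict_mem measurableSet_Ioo] with r h1 h2 hr
    have h3 : (Real.sqrt r : ℂ) * Real.sqrt r = r := by
      rw [← Complex.ofReal_mul, Real.mul_self_sqrt (hb.trans hr.1).le]
    rw [h1, h2, RCLike.inner_apply, Complex.real_smul, Complex.real_smul, map_mul,
      Complex.conj_ofReal, ← h3]
    ring
  rw [formLift, formLift, WithLp.prod_inner_apply]
  refine congrArg₂ _ ?_ e
  rw [inner_smul_left, inner_smul_right, Complex.conj_ofReal]
  push_cast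
  ring

/-- The vector representing `u ↦ ⟨u, f⟩` on the form domain before projection. -/
def sourceMap (b k : ℝ) : L2 b →L[ℂ] EnergySpace b :=
  ((WithLp.prodContinuousLinearEquiv 2 ℂ (L2 b) (L2 b)).symm : _ →L[ℂ] _) ∘L
    (((k⁻¹ : ℝ) : ℂ) • ContinuousLinearMap.inl ℂ (L2 b) (L2 b))

theorem sourceMap_apply (f : L2 b) :
    sourceMap b k f = WithLp.toLp 2 (((k⁻¹ : ℝ) : ℂ) • f, 0) := by
  change WithLp.toLp 2 (((k⁻¹ : ℝ) : ℂ) • (f, (0 : L2 b))) = _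
  rw [Prod.smul_mk, smul_zero]

theorem inner_sourceMap (x : EnergySpace b) (f : L2 b) :
    inner ℂ x (sourceMap b k f) = inner ℂ (((k⁻¹ : ℝ) : ℂ) • x.fst) f := by
  rw [sourceMap_apply, WithLp.prod_inner_apply, inner_zero_right, add_zero, inner_smul_right,
    inner_smul_left, Complex.conj_ofReal]
  rfl

theorem inner_formLift_sourceMap (hk : 0 < k) (u f : L2 b) :
    inner ℂ (formLift b k u) (sourceMap b k f) = inner ℂ u f := by
  have e : ((k⁻¹ : ℝ) : ℂ) • (formLift b k u).fst = u := by
    change ((k⁻¹ : ℝ) : ℂ) • ((k : ℝ) : ℂ) • u = u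
    rw [smul_smul, ← Complex.ofReal_mul, inv_mul_cancel₀ hk.ne', Complex.ofReal_one, one_smul]
  rw [inner_sourceMap, e]

/-- The resolvent `(H_b + k²)⁻¹`. -/
def resolventMap (b k : ℝ) : L2 b →L[ℂ] L2 b :=
  (((k⁻¹ : ℝ) : ℂ) • WithLp.fstL 2 ℂ (L2 b) (L2 b)) ∘L formProjection b k ∘L sourceMap b k

theorem resolventMap_apply (f : L2 b) :
    resolventMap b k f = ((k⁻¹ : ℝ) : ℂ) • (formProjection b k (sourceMap b k f)).fst := rfl

/-- Riesz representation: the projected source vector represents `v ↦ ⟨v, f⟩` on the form domain,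
hence is the lift of the solution. Conversely, if `H_b u = f`, the lift of `u` satisfies the
conditions characterising the projection of the source of `f + k² u`. -/
theorem isResolvent_resolventMap (hb : 0 < b) (hk : 0 < k) :
    IsResolvent b k (resolventMap b k) := by
  refine ⟨fun f => ?_, fun u f h => ?_⟩
  · obtain ⟨h1, h2⟩ := formLift_of_mem hb hk (formProjection_mem (k := k) (sourceMap b k f))
    rw [← resolventMap_apply] at h1 h2
    refine ⟨h1, fun v hv => ?_⟩
    have e := inner_formLift (k := k) hb h1 hv
    rw [h2, inner_formProjection_of_mem (formLift_mem hb hv), inner_formLift_sourceMap hk] at e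
    rw [inner_sub_right, inner_smul_right, e]
    ring
  · have hP : formProjection b k (sourceMap b k (f + ((k ^ 2 : ℝ) : ℂ) • u)) =
        formLift b k u := by
      refine Submodule.eq_starProjection_of_mem_of_inner_eq_zero (formLift_mem hb h.1)
        fun w hw => ?_
      obtain ⟨h1, h2⟩ := formLift_of_mem hb hk hw
      rw [← h2, ← inner_conj_symm, inner_sub_right, inner_formLift_sourceMap hk,
        inner_formLift hb h.1 h1, h.2 _ h1, inner_add_right, inner_smul_right]
      rw [add_comm, sub_self, map_zero]
    rw [resolventMap_apply, hP]
    change ((k⁻¹ : ℝ) : ℂ) • ((k : ℝ) : ℂ) • u = u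
    rw [smul_smul, ← Complex.ofReal_mul, inv_mul_cancel₀ hk.ne', Complex.ofReal_one, one_smul]

end lift

/-! ### Point evaluation and the reproducing kernel -/

section evaluation

variable {b k : ℝ}

/-- The function `s ↦ s^{-1/2}` truncated to `s < r`. -/
def truncInvSqrt (r s : ℝ) : ℝ := (Iio r).indicator (fun s => (Real.sqrt s)⁻¹) s

/-- The vector whose inner product with `(k u, √r (u / √r)')` is `u r`. -/
def evalVector (b k r : ℝ) : EnergySpace b :=
  realVector b (fun s => Real.sqrt r * (k⁻¹ * (Real.sqrt s)⁻¹))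
    (fun s => Real.sqrt r * (truncInvSqrt r s - (b + 1 - s) * (Real.sqrt s)⁻¹))

theorem memLp_truncInvSqrt (hb : 0 < b) (r : ℝ) :
    MemLp (fun s => (truncInvSqrt r s : ℂ)) 2 (intervalMeasure b) := by
  have h := (memLp_ofReal (continuousOn_inv_sqrt hb)).indicator (s := Iio r) measurableSet_Iio
  convert h using 2 with s
  by_cases hs : s ∈ Iio r <;> simp [truncInvSqrt, hs]

theorem continuousOn_mul_inv_sqrt (hb : 0 < b) :
    ContinuousOn (fun s => (b + 1 - s) * (Real.sqrt s)⁻¹) (Icc b (b + 1)) :=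
  (by fun_prop : ContinuousOn (fun s : ℝ => b + 1 - s) _).mul (continuousOn_inv_sqrt hb)

theorem memLp_evalVector_fst (hb : 0 < b) (r : ℝ) :
    MemLp (fun s => ((Real.sqrt r * (k⁻¹ * (Real.sqrt s)⁻¹) : ℝ) : ℂ)) 2
      (intervalMeasure b) :=
  memLp_ofReal (continuousOn_const.mul (continuousOn_const.mul (continuousOn_inv_sqrt hb)))

theorem memLp_evalVector_snd (hb : 0 < b) (r : ℝ) :
    MemLp (fun s => ((Real.sqrt r * (truncInvSqrt r s - (b + 1 - s) * (Real.sqrt s)⁻¹) : ℝ) : ℂ))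
      2 (intervalMeasure b) := by
  have h := ((memLp_truncInvSqrt hb r).sub
    (memLp_ofReal (continuousOn_mul_inv_sqrt hb))).const_mul (Real.sqrt r : ℂ)
  convert h using 2 with s
  simp

theorem conjVector_evalVector (hb : 0 < b) (r : ℝ) :
    conjVector (evalVector b k r) = evalVector b k r :=
  conjVector_realVector (memLp_evalVector_fst hb r) (memLp_evalVector_snd hb r)

/-- The formula of `HasWeakDeriv.ae_eq_primitive` recovers `u(r)/√r` from integrals of `u/√s` and
its weak derivative; each is a pairing with one component of `evalVector`. -/
theorem inner_evalVector (hb : 0 < b) (hk : 0 < k) {x : EnergySpace b}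
    (hx : x ∈ formSubspace b k) :
    ∀ᵐ r ∂intervalMeasure b, ((k⁻¹ : ℝ) : ℂ) * x.fst r = inner ℂ (evalVector b k r) x := by
  rw [mem_formSubspace_iff hb] at hx
  have hv := integrable_of_memLp (memLp_smul (continuousOn_inv_sqrt hb) (Lp.memLp x.fst))
  have hz0 := integrable_of_memLp (memLp_smul (continuousOn_inv_sqrt hb) (Lp.memLp x.snd))
  have hz : Integrable (fun r => (k * (Real.sqrt r)⁻¹) • x.snd r) (intervalMeasure b) :=
    integrable_of_memLp (memLp_smul (continuousOn_const.mul (continuousOn_inv_sqrt hb))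
      (Lp.memLp x.snd))
  filter_upwards [hx.ae_eq_primitive hv hz, ae_restrict_mem measurableSet_Ioo] with r hr hrI
  have hs : Real.sqrt r ≠ 0 := (Real.sqrt_pos.2 (hb.trans hrI.1)).ne'
  have e1 : ∫ s in Ioo b (b + 1), (Real.sqrt r * (k⁻¹ * (Real.sqrt s)⁻¹)) • x.fst s =
      (Real.sqrt r * k⁻¹) • ∫ s in Ioo b (b + 1), (Real.sqrt s)⁻¹ • x.fst s := by
    rw [← integral_smul]
    refine setIntegral_congr_fun measurableSet_Ioo fun s _ => ?_
    simp only [smul_smul, mul_assoc]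
  have i2 := integrable_smul (b := b) (a := fun s => b + 1 - s) (by fun_prop) hz
  have i3 : Integrable ((Iio r).indicator fun s => (k * (Real.sqrt s)⁻¹) • x.snd s)
      (intervalMeasure b) := hz.indicator measurableSet_Iio
  have e3 : ∫ s in Ioo b (b + 1), (Iio r).indicator (fun s => (k * (Real.sqrt s)⁻¹) • x.snd s) s =
      ∫ s in b..r, (k * (Real.sqrt s)⁻¹) • x.snd s := by
    rw [integral_indicator measurableSet_Iio, Measure.restrict_restrict measurableSet_Iio,
      intervalIntegral.integral_of_le hrI.1.le, integral_Ioc_eq_integral_Ioo]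
    congr 2
    ext s
    simp only [mem_inter_iff, mem_Iio, mem_Ioo]
    exact ⟨fun h => ⟨h.2.1, h.1⟩, fun h => ⟨h.2, h.1, h.2.trans hrI.2⟩⟩
  have e2 : ∫ s in Ioo b (b + 1),
      (Real.sqrt r * (truncInvSqrt r s - (b + 1 - s) * (Real.sqrt s)⁻¹)) • x.snd s =
      (Real.sqrt r * k⁻¹) • ((∫ s in b..r, (k * (Real.sqrt s)⁻¹) • x.snd s) -
        ∫ s in Ioo b (b + 1), (b + 1 - s) • (k * (Real.sqrt s)⁻¹) • x.snd s) := by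
    rw [← e3, ← integral_sub i3 i2, ← integral_smul]
    refine setIntegral_congr_fun measurableSet_Ioo fun s _ => ?_
    by_cases h : s ∈ Iio r
    · simp only [truncInvSqrt, indicator_of_mem h, smul_smul, ← sub_smul]
      congr 1
      field_simp
    · simp only [truncInvSqrt, indicator_of_notMem h, smul_smul, zero_sub, ← neg_smul]
      congr 1
      field_simp
  rw [evalVector, inner_realVector (memLp_evalVector_fst hb r) (memLp_evalVector_snd hb r),
    e1, e2, ← smul_add]
  have e4 : ((k⁻¹ : ℝ) : ℂ) * x.fst r = (Real.sqrt r * k⁻¹) • ((Real.sqrt r)⁻¹ • x.fst r) := by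
    rw [smul_smul, ← Complex.real_smul]
    congr 1
    field_simp
  rw [e4, hr]
  congr 1
  ring

theorem toL2_add {f g : ℝ → ℂ} (hf : MemLp f 2 (intervalMeasure b))
    (hg : MemLp g 2 (intervalMeasure b)) : toL2 b (fun s => f s + g s) = toL2 b f + toL2 b g := by
  refine Lp.ext ?_
  filter_upwards [coeFn_toL2 hf, coeFn_toL2 hg, coeFn_toL2 (hf.add hg),
    Lp.coeFn_add (toL2 b f) (toL2 b g)] with s h1 h2 h3 h4
  rw [h4, Pi.add_apply, h1, h2]
  exact h3

theorem toL2_const_mul {f : ℝ → ℂ} (hf : MemLp f 2 (intervalMeasure b)) (c : ℂ) :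
    toL2 b (fun s => c * f s) = c • toL2 b f := by
  refine Lp.ext ?_
  filter_upwards [coeFn_toL2 hf, coeFn_toL2 (hf.const_mul c),
    Lp.coeFn_smul c (toL2 b f)] with s h1 h2 h3
  rw [h3, Pi.smul_apply, h1, h2, smul_eq_mul]

/-- The difference is `s^(-1/2)` on `[x, y)`, bounded there by `b^(-1/2)`. This Hölder estimate is
the source of the continuity of the Green function. -/
theorem norm_toL2_truncInvSqrt_sub_le (hb : 0 < b) {x y : ℝ} (hxy : x ≤ y) :
    ‖toL2 b (fun s => (truncInvSqrt y s : ℂ)) - toL2 b (fun s => (truncInvSqrt x s : ℂ))‖ ≤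
      (Real.sqrt b)⁻¹ * (y - x) ^ (1 / 2 : ℝ) := by
  have hfin : intervalMeasure b (Ico x y) ≠ ⊤ := measure_ne_top _ _
  have h1 : ‖toL2 b (fun s => (truncInvSqrt y s : ℂ)) -
      toL2 b (fun s => (truncInvSqrt x s : ℂ))‖ ≤
      (Real.sqrt b)⁻¹ * ‖indicatorConstLp 2 (measurableSet_Ico (a := x) (b := y)) hfin (1 : ℂ)‖ := by
    refine Lp.norm_le_mul_norm_of_ae_le_mul ?_
    filter_upwards [Lp.coeFn_sub (toL2 b (fun s => (truncInvSqrt y s : ℂ)))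
      (toL2 b (fun s => (truncInvSqrt x s : ℂ))), coeFn_toL2 (memLp_truncInvSqrt hb x),
      coeFn_toL2 (memLp_truncInvSqrt hb y),
      indicatorConstLp_coeFn (p := 2) (hs := measurableSet_Ico (a := x) (b := y)) (hμs := hfin)
        (c := (1 : ℂ)), ae_restrict_mem measurableSet_Ioo] with s h1 h2 h3 h4 hs
    rw [h1, Pi.sub_apply, h2, h3, h4, ← Complex.ofReal_sub, Complex.norm_real]
    have hle : (Real.sqrt s)⁻¹ ≤ (Real.sqrt b)⁻¹ :=
      inv_anti₀ (Real.sqrt_pos.2 hb) (Real.sqrt_le_sqrt hs.1.le)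
    rcases lt_or_ge s x with h | h
    · simp [truncInvSqrt, h, h.trans_le hxy, h.not_ge]
    · rcases lt_or_ge s y with h' | h'
      · simpa [truncInvSqrt, h, h', h.not_gt, abs_of_nonneg (Real.sqrt_nonneg s)] using hle
      · simp [truncInvSqrt, h.not_gt, h'.not_gt]
  refine h1.trans ?_
  gcongr
  rw [norm_indicatorConstLp (by norm_num) (by norm_num), norm_one, one_mul]
  simp only [ENNReal.toReal_ofNat]
  gcongr
  refine (ENNReal.toReal_mono (by simp) (Measure.restrict_apply_le _ _)).trans ?_
  simp [hxy]

theorem continuous_toL2_truncInvSqrt (hb : 0 < b) :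
    Continuous fun r => toL2 b (fun s => (truncInvSqrt r s : ℂ)) := by
  rw [continuous_iff_continuousAt]
  intro x
  rw [ContinuousAt, tendsto_iff_norm_sub_tendsto_zero]
  refine squeeze_zero (fun _ => norm_nonneg _)
    (g := fun y => (Real.sqrt b)⁻¹ * |y - x| ^ (1 / 2 : ℝ)) (fun y => ?_) ?_
  · rcases le_total x y with h | h
    · rw [abs_of_nonneg (by linarith)]
      exact norm_toL2_truncInvSqrt_sub_le hb h
    · rw [norm_sub_rev, abs_sub_comm, abs_of_nonneg (by linarith)]
      exact norm_toL2_truncInvSqrt_sub_le hb h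
  · have : Continuous fun y : ℝ => (Real.sqrt b)⁻¹ * |y - x| ^ (1 / 2 : ℝ) :=
      continuous_const.mul ((continuous_id.sub continuous_const).abs.rpow_const
        fun _ => Or.inr (by norm_num))
    simpa using this.tendsto x

theorem continuous_evalVector (hb : 0 < b) : Continuous (evalVector b k) := by
  have e : evalVector b k = fun r => WithLp.toLp 2
      ((Real.sqrt r : ℂ) • toL2 b (fun s => ((k⁻¹ * (Real.sqrt s)⁻¹ : ℝ) : ℂ)),
        (Real.sqrt r : ℂ) • (toL2 b (fun s => (truncInvSqrt r s : ℂ)) +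
          toL2 b (fun s => ((-((b + 1 - s) * (Real.sqrt s)⁻¹) : ℝ) : ℂ)))) := by
    ext1 r
    have m1 : MemLp (fun s => ((k⁻¹ * (Real.sqrt s)⁻¹ : ℝ) : ℂ)) 2 (intervalMeasure b) :=
      memLp_ofReal (continuousOn_const.mul (continuousOn_inv_sqrt hb))
    have m2 : MemLp (fun s => ((-((b + 1 - s) * (Real.sqrt s)⁻¹) : ℝ) : ℂ)) 2
        (intervalMeasure b) := memLp_ofReal (continuousOn_mul_inv_sqrt hb).neg
    rw [← toL2_const_mul m1, ← toL2_add (memLp_truncInvSqrt hb r) m2,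
      ← toL2_const_mul (f := fun s => (truncInvSqrt r s : ℂ) +
        ((-((b + 1 - s) * (Real.sqrt s)⁻¹) : ℝ) : ℂ)) ((memLp_truncInvSqrt hb r).add m2),
      evalVector, realVector]
    simp only [sub_eq_add_neg, Complex.ofReal_mul, Complex.ofReal_add, Complex.ofReal_neg]
  rw [e]
  refine (WithLp.prod_continuous_toLp 2 _ _).comp (Continuous.prodMk ?_ ?_)
  · exact (Complex.continuous_ofReal.comp Real.continuous_sqrt).smul continuous_const
  · exact (Complex.continuous_ofReal.comp Real.continuous_sqrt).smul
      ((continuous_toL2_truncInvSqrt hb).add continuous_const)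

/-- The Green function, as the reproducing kernel of the form domain. -/
def greenFunction (b k r s : ℝ) : ℝ :=
  (inner ℂ (evalVector b k r) (formProjection b k (evalVector b k s)) : ℂ).re

theorem ofReal_greenFunction (hb : 0 < b) (r s : ℝ) : (greenFunction b k r s : ℂ) =
    inner ℂ (evalVector b k r) (formProjection b k (evalVector b k s)) :=
  inner_real_of_conjVector_eq (conjVector_evalVector hb r)
    (conjVector_formProjection hb (conjVector_evalVector hb s))

theorem greenFunction_comm (r s : ℝ) : greenFunction b k r s = greenFunction b k s r := by
  rw [greenFunction, greenFunction, ← inner_formProjection_comm, ← inner_conj_symm,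
    Complex.conj_re]

/-- With `e` for `evalVector`, `P` for the projection and `S` for `sourceMap`, `(R f)(r) = ⟨e_r, P S
f⟩ = ⟨P e_r, S f⟩`. The last pairing is an `L²` product of `f` with a function whose value at `s` is
`⟨e_s, P e_r⟩`. -/
theorem isGreenFunction_greenFunction (hb : 0 < b) (hk : 0 < k) :
    IsGreenFunction b k (greenFunction b k) := by
  refine ⟨?_, resolventMap b k, isResolvent_resolventMap hb hk, fun f => ?_⟩
  · have h1 : Continuous fun p : ℝ × ℝ => (inner ℂ (evalVector b k p.1)
        (formProjection b k (evalVector b k p.2)) : ℂ) :=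
      ((continuous_evalVector hb).comp continuous_fst).inner
        ((formProjection b k).continuous.comp ((continuous_evalVector hb).comp continuous_snd))
    exact (Complex.continuous_re.comp h1).continuousOn
  · filter_upwards [inner_evalVector hb hk (formProjection_mem (k := k) (sourceMap b k f)),
      Lp.coeFn_smul ((k⁻¹ : ℝ) : ℂ) (formProjection b k (sourceMap b k f)).fst] with r h1 h2
    rw [resolventMap_apply, h2, Pi.smul_apply, smul_eq_mul, h1, ← inner_formProjection_comm,
      inner_sourceMap, L2.inner_def]
    refine integral_congr_ae ?_
    filter_upwards [inner_evalVector hb hk (formProjection_mem (k := k) (evalVector b k r)),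
      Lp.coeFn_smul ((k⁻¹ : ℝ) : ℂ) (formProjection b k (evalVector b k r)).fst] with s h3 h4
    rw [h4, Pi.smul_apply, smul_eq_mul, h3, ← ofReal_greenFunction hb, RCLike.inner_apply,
      Complex.conj_ofReal, greenFunction_comm, mul_comm]

end evaluation

end RadialNeumann

end

/-! ### Assembly of the constants -/

theorem proposition3p2 :
    (∀ b k : ℝ, 0 < b → 0 < k → ∃ G : ℝ → ℝ → ℝ, RadialNeumann.IsGreenFunction b k G) ∧
    (∀ k α : ℝ, 0 < k → 0 ≤ α → α < 1 →
      ∃ C : ℝ, 0 < C ∧ ∀ b : ℝ, 0 < b →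
        ∀ G : ℝ → ℝ → ℝ, RadialNeumann.IsGreenFunction b k G →
          ∀ r : ℝ, b ≤ r → r ≤ b + 1 → G r r ≤ C * r ^ α) ∧
    (∀ b : ℝ, 0 < b →
      ∀ G : ℝ → ℝ → ℝ, RadialNeumann.IsGreenFunction b (3.555 : ℝ) G →
        ∀ r : ℝ, b ≤ r → r ≤ b + 1 → G r r ≤ 1 / 3) := by
  refine ⟨fun b k hb hk => ⟨_, RadialNeumann.isGreenFunction_greenFunction hb hk⟩, fun k α hk hα hα1 => ?_,
    fun b hb G hG r h1 h2 => hG.diagonal_le_third hb ⟨h1, h2⟩⟩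
  have hβ : 0 < 1 - α := by linarith
  -- From `ε ≤ 1` follows `2ε + ε² ≤ 3ε ≤ k²`.
  set ε : ℝ := min 1 (k ^ 2 / 3) with hε
  have hε0 : 0 < ε := by positivity
  have hεk : 2 * ε + ε ^ 2 ≤ k ^ 2 := by
    have h1 : ε ≤ 1 := min_le_left _ _
    have h2 : ε ≤ k ^ 2 / 3 := min_le_right _ _
    nlinarith
  set c : ℝ := min ((1 - α) / 2) (k ^ 2 * (1 - α) / 12) with hc
  have hc0 : 0 < c := by positivity
  have hc1 : c ≤ (1 - α) / 2 := min_le_left _ _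
  have hc2 : 12 * c ≤ k ^ 2 * (1 - α) := by
    have : c ≤ k ^ 2 * (1 - α) / 12 := min_le_right _ _
    linarith
  refine ⟨2 / c + 4 / ε, by positivity, fun b hb G hG r h1 h2 => ?_⟩
  have hr0 : 0 < r := hb.trans_le h1
  have hp : 0 < r ^ α := Real.rpow_pos_of_pos hr0 _
  rw [add_mul]
  rcases le_total r (1 / 2) with h | h
  · refine (hG.diagonal_le_rpow hb hα hc0 hc1 hc2 ⟨h1, h2⟩ h).trans ?_
    have : 0 ≤ 4 / ε * r ^ α := by positivity
    linarith
  · refine (hG.diagonal_le_uniform hb hε0 hεk ⟨h1, h2⟩).trans ?_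
    -- For `r ≥ 1/2` this lets the uniform bound `2/ε` be absorbed into `(4/ε) r^α`.
    have hrα : (1 / 2 : ℝ) ≤ r ^ α := by
      calc (1 / 2 : ℝ) = (1 / 2 : ℝ) ^ (1 : ℝ) := (Real.rpow_one _).symm
        _ ≤ (1 / 2 : ℝ) ^ α := Real.rpow_le_rpow_of_exponent_ge (by norm_num) (by norm_num) hα1.le
        _ ≤ r ^ α := Real.rpow_le_rpow (by norm_num) h hα
    have h3 : 4 / ε * (1 / 2) ≤ 4 / ε * r ^ α := by gcongr
    have h4 : 4 / ε * (1 / 2) = 2 / ε := by ring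
    have h5 : 0 ≤ 2 / c * r ^ α := by positivity
    linarith
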